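/- Let $D\in C^2([0,1];\mathbb{R})$ satisfy $D(0)=0$, $D(u)>0$ for $u\in(0,1]$ and $D'(u)>0$ for $u\in[0,1]$. Let $\alpha\in(0,1)$ and let $f\in C^2([0,1];\mathbb{R})$ be of bistable type: $f(0)=f(\alpha)=f(1)=0$, $f'(0)<0$, $f'(1)<0$, $f'(\alpha)>0$, $f<0$ on $(0,\alpha)$ and $f>0$ on $(\alpha,1)$. Assume $\int_0^1 D(u)f(u)\,du=0$. Let $\varphi:\mathbb{R}\to\mathbb{R}$ be a stationary front of $u_t=(D(u)u_x)_x+f(u)$ connecting $1$ with $0$, that is, a non-increasing differentiable function such that $D(\varphi)\varphi_x$ is differentiable, $$(D(\varphi)\varphi_x)_x+f(\varphi)=0\quad\text{on }\mathbb{R},\qquad \lim_{x\to-\infty}\varphi(x)=1,\qquad \lim_{x\to+\infty}\varphi(x)=0 .$$ Let $\mathcal{L}$ be the linearized operator in the complex space $L^2(\mathbb{R})$, $$\mathcal{L}u=(D(\varphi)u)_{xx}+f'(\varphi)u,\qquad \mathcal{D}(\mathcal{L})=\{u\in L^2(\mathbb{R}) : D(\varphi)u\in H^2(\mathbb{R})\},$$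 and let $\sigma_{\mathrm{pt}}(\mathcal{L})=\{\lambda\in\mathbb{C} : \mathcal{L}-\lambda\text{ is not injective}\}$. Then the point spectrum of $\mathcal{L}$ is real and stable: there exists $\mu_0>0$ such that $$\sigma_{\mathrm{pt}}(\mathcal{L})\subset(-\infty,-\mu_0]\cup\{0\}.$$ Moreover, $\lambda=0$ is a simple eigenvalue of $\mathcal{L}$, that is, its geometric multiplicity $\dim\ker\mathcal{L}$ and its algebraic multiplicity $\dim\bigcup_{n\ge1}\ker\mathcal{L}^n$ are both equal to one, and $\varphi_x\in\mathcal{D}(\mathcal{L})$ is an associated eigenfunction: $\varphi_x\neq0$ and $\mathcal{L}\varphi_x=0$. -/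

import Mathlib

open MeasureTheory Filter Topology Set
open scoped ContDiff

/-- The complex Hilbert space `L²(ℝ)` (Lebesgue measure). -/
abbrev L2 : Type := Lp ℂ 2 (volume : Measure ℝ)

/-! ### The equation and its stationary front -/

/-- The degenerate diffusivities: `D ∈ C²([0,1])`, `D(0) = 0`, `D > 0` on `(0,1]`, `D' > 0` on
`[0,1]` (one-sided derivatives at the end points). -/
structure IsDegenerateDiffusivity (D : ℝ → ℝ) : Prop where
  contDiffOn : ContDiffOn ℝ 2 D (Icc 0 1)
  map_zero : D 0 = 0
  pos : ∀ u ∈ Ioc (0 : ℝ) 1, 0 < D u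
  deriv_pos : ∀ u ∈ Icc (0 : ℝ) 1, 0 < derivWithin D (Icc 0 1) u

/-- The reaction terms of bistable (Nagumo) type with intermediate zero `α`. -/
structure IsBistable (f : ℝ → ℝ) (α : ℝ) : Prop where
  mem_Ioo : α ∈ Ioo (0 : ℝ) 1
  contDiffOn : ContDiffOn ℝ 2 f (Icc 0 1)
  map_zero : f 0 = 0
  map_alpha : f α = 0
  map_one : f 1 = 0
  deriv_zero_neg : derivWithin f (Icc 0 1) 0 < 0
  deriv_one_neg : derivWithin f (Icc 0 1) 1 < 0
  deriv_alpha_pos : 0 < derivWithin f (Icc 0 1) α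
  pos : ∀ u ∈ Ioo α 1, 0 < f u
  neg : ∀ u ∈ Ioo 0 α, f u < 0

/-- `φ` is a monotone stationary front of `u_t = (D(u) u_x)_x + f(u)` which connects `u = 1` (at
`-∞`) with the degenerate state `u = 0` (at `+∞`): a solution of
`(D(φ) φ_x)_x + f(φ) = 0` on the whole line with these limits. -/
structure IsStationaryFront (D f φ : ℝ → ℝ) : Prop where
  differentiable : Differentiable ℝ φ
  profile_eq : ∀ x, HasDerivAt (fun y => D (φ y) * deriv φ y) (-f (φ x)) x
  antitone : Antitone φ
  tendsto_atBot : Tendsto φ atBot (𝓝 1)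
  tendsto_atTop : Tendsto φ atTop (𝓝 0)

theorem IsStationaryFront.mem_Icc {D f φ : ℝ → ℝ} (hφ : IsStationaryFront D f φ) (x : ℝ) :
    φ x ∈ Icc (0 : ℝ) 1 :=
  ⟨hφ.antitone.le_of_tendsto hφ.tendsto_atTop x, hφ.antitone.ge_of_tendsto hφ.tendsto_atBot x⟩

/-! ### Weak derivatives and `H²(ℝ)` -/

/-- `v` is the weak derivative of `w` (both locally integrable) on `ℝ`. -/
def IsWeakDeriv (w v : ℝ → ℂ) : Prop :=
  ∀ η : ℝ → ℝ, ContDiff ℝ ∞ η → HasCompactSupport η →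
    ∫ x, deriv η x • w x = -∫ x, η x • v x

/-- `w ∈ H²(ℝ)` and its second weak derivative is `v`. -/
def IsH2WithSecondDeriv (w v : ℝ → ℂ) : Prop :=
  MemLp w 2 volume ∧ MemLp v 2 volume ∧
    ∃ w₁ : ℝ → ℂ, MemLp w₁ 2 volume ∧ IsWeakDeriv w w₁ ∧ IsWeakDeriv w₁ v

/-- `w ∈ H²(ℝ)`: `w` and its first two weak derivatives are square integrable. -/
def MemH2 (w : ℝ → ℂ) : Prop := ∃ v, IsH2WithSecondDeriv w v

section WeakDerivLemmas

variable {w w' v v' : ℝ → ℂ}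

theorem integrable_test_smul {η : ℝ → ℝ} (hη : Continuous η) (hc : HasCompactSupport η)
    (hw : MemLp w 2 volume) : Integrable (fun x => η x • w x) :=
  (hw.locallyIntegrable (by norm_num)).integrable_smul_left_of_hasCompactSupport hη hc

theorem IsWeakDeriv.congr (h : IsWeakDeriv w v) (hw : w =ᵐ[volume] w') (hv : v =ᵐ[volume] v') :
    IsWeakDeriv w' v' := by
  intro η h1 h2
  have := h η h1 h2
  rw [integral_congr_ae (g := fun x => deriv η x • w' x)
      (by filter_upwards [hw] with x hx using by simp [hx]),
    integral_congr_ae (f := fun x => η x • v x) (g := fun x => η x • v' x)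
      (by filter_upwards [hv] with x hx using by simp [hx])] at this
  exact this

theorem IsWeakDeriv.add (h : IsWeakDeriv w v) (h' : IsWeakDeriv w' v')
    (hw : MemLp w 2 volume) (hv : MemLp v 2 volume)
    (hw' : MemLp w' 2 volume) (hv' : MemLp v' 2 volume) :
    IsWeakDeriv (w + w') (v + v') := by
  intro η h1 h2
  have hd : Continuous (deriv η) := h1.continuous_deriv (by simp)
  have hdc : HasCompactSupport (deriv η) := h2.deriv
  simp only [Pi.add_apply, smul_add]
  rw [integral_add (integrable_test_smul hd hdc hw) (integrable_test_smul hd hdc hw'),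
    integral_add (integrable_test_smul h1.continuous h2 hv)
      (integrable_test_smul h1.continuous h2 hv'), h η h1 h2, h' η h1 h2]
  ring

theorem IsWeakDeriv.const_smul (c : ℂ) (h : IsWeakDeriv w v) :
    IsWeakDeriv (c • w) (c • v) := by
  intro η h1 h2
  have := h η h1 h2
  simp only [Pi.smul_apply, smul_comm _ c, integral_smul, this, smul_neg]

theorem IsWeakDeriv.unique (h : IsWeakDeriv w v) (h' : IsWeakDeriv w v')
    (hv : MemLp v 2 volume) (hv' : MemLp v' 2 volume) : v =ᵐ[volume] v' := by
  refine ae_eq_of_integral_contDiff_smul_eq (hv.locallyIntegrable (by norm_num))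
    (hv'.locallyIntegrable (by norm_num)) fun η h1 h2 => ?_
  exact neg_injective ((h η h1 h2).symm.trans (h' η h1 h2))

theorem IsH2WithSecondDeriv.congr (h : IsH2WithSecondDeriv w v) (hw : w =ᵐ[volume] w')
    (hv : v =ᵐ[volume] v') : IsH2WithSecondDeriv w' v' := by
  obtain ⟨a, b, w₁, c, d, e⟩ := h
  exact ⟨(memLp_congr_ae hw).1 a, (memLp_congr_ae hv).1 b, w₁, c, d.congr hw .rfl,
    e.congr .rfl hv⟩

theorem IsH2WithSecondDeriv.add (h : IsH2WithSecondDeriv w v) (h' : IsH2WithSecondDeriv w' v') :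
    IsH2WithSecondDeriv (w + w') (v + v') := by
  obtain ⟨a, b, w₁, c, d, e⟩ := h
  obtain ⟨a', b', w₁', c', d', e'⟩ := h'
  exact ⟨a.add a', b.add b', w₁ + w₁', c.add c', d.add d' a c a' c', e.add e' c b c' b'⟩

theorem IsH2WithSecondDeriv.const_smul (k : ℂ) (h : IsH2WithSecondDeriv w v) :
    IsH2WithSecondDeriv (k • w) (k • v) := by
  obtain ⟨a, b, w₁, c, d, e⟩ := h
  exact ⟨a.const_smul k, b.const_smul k, k • w₁, c.const_smul k, d.const_smul k, e.const_smul k⟩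

theorem IsH2WithSecondDeriv.unique (h : IsH2WithSecondDeriv w v)
    (h' : IsH2WithSecondDeriv w v') : v =ᵐ[volume] v' := by
  obtain ⟨_, b, w₁, c, d, e⟩ := h
  obtain ⟨_, b', w₁', c', d', e'⟩ := h'
  exact e.unique (e'.congr (d'.unique d c' c) .rfl) b b'

theorem isH2WithSecondDeriv_zero : IsH2WithSecondDeriv 0 0 :=
  ⟨MemLp.zero', MemLp.zero', 0, MemLp.zero', fun _ _ _ => by simp, fun _ _ _ => by simp⟩

end WeakDerivLemmas

/-! ### The linearized operator -/

/-- The function `x ↦ D(φ(x)) u(x)`. -/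
def diffMul (D φ : ℝ → ℝ) (u : ℝ → ℂ) : ℝ → ℂ := fun x => (D (φ x) : ℂ) * u x

/-- The function `x ↦ f'(φ(x)) u(x)`. -/
noncomputable def reactMul (f φ : ℝ → ℝ) (u : ℝ → ℂ) : ℝ → ℂ :=
  fun x => ((derivWithin f (Icc 0 1) (φ x) : ℝ) : ℂ) * u x

theorem diffMul_add_ae (D φ : ℝ → ℝ) (u v : L2) :
    diffMul D φ u + diffMul D φ v =ᵐ[volume] diffMul D φ ⇑(u + v) := by
  filter_upwards [Lp.coeFn_add u v] with x hx
  simp only [diffMul, Pi.add_apply, hx, mul_add]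

theorem diffMul_smul_ae (D φ : ℝ → ℝ) (c : ℂ) (u : L2) :
    c • diffMul D φ u =ᵐ[volume] diffMul D φ ⇑(c • u) := by
  filter_upwards [Lp.coeFn_smul c u] with x hx
  simp only [diffMul, Pi.smul_apply, smul_eq_mul, hx, mul_left_comm]

/-- The domain `{u ∈ L²(ℝ) : D(φ) u ∈ H²(ℝ)}`. -/
def linDomain (D φ : ℝ → ℝ) : Submodule ℂ L2 where
  carrier := {u | MemH2 (diffMul D φ u)}
  add_mem' := by
    rintro u v ⟨a, ha⟩ ⟨b, hb⟩
    exact ⟨a + b, (ha.add hb).congr (diffMul_add_ae D φ u v) .rfl⟩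
  zero_mem' := ⟨0, isH2WithSecondDeriv_zero.congr (by
    filter_upwards [Lp.coeFn_zero ℂ 2 (volume : Measure ℝ)] with x hx
    simp only [diffMul, hx, Pi.zero_apply, mul_zero]) .rfl⟩
  smul_mem' := by
    rintro c u ⟨a, ha⟩
    exact ⟨c • a, (ha.const_smul c).congr (diffMul_smul_ae D φ c u) .rfl⟩

theorem memLp_reactMul {D f φ : ℝ → ℝ} {α : ℝ} (hf : IsBistable f α)
    (hφ : IsStationaryFront D f φ) (u : L2) : MemLp (reactMul f φ u) 2 volume := by
  have hc : ContinuousOn (derivWithin f (Icc 0 1)) (Icc 0 1) :=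
    hf.contDiffOn.continuousOn_derivWithin (uniqueDiffOn_Icc zero_lt_one) (by norm_num)
  obtain ⟨C, hC⟩ := isCompact_Icc.exists_bound_of_continuousOn hc
  have hcont : Continuous fun x => derivWithin f (Icc 0 1) (φ x) :=
    hc.comp_continuous hφ.differentiable.continuous hφ.mem_Icc
  refine MemLp.of_le_mul (c := C) (Lp.memLp u)
    ((Complex.continuous_ofReal.comp hcont).aestronglyMeasurable.mul
      (Lp.aestronglyMeasurable u)) (ae_of_all _ fun x => ?_)
  simp only [reactMul, norm_mul, Complex.norm_real]
  exact mul_le_mul_of_nonneg_right (hC _ (hφ.mem_Icc x)) (norm_nonneg _)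

/-- The second weak derivative `(D(φ) u)_xx` of an element `u` of the domain. -/
noncomputable def linSecondDeriv {D φ : ℝ → ℝ} (u : linDomain D φ) : ℝ → ℂ :=
  Classical.choose (show MemH2 (diffMul D φ u.1) from u.2)

theorem linSecondDeriv_spec {D φ : ℝ → ℝ} (u : linDomain D φ) :
    IsH2WithSecondDeriv (diffMul D φ u.1) (linSecondDeriv u) :=
  Classical.choose_spec (show MemH2 (diffMul D φ u.1) from u.2)

theorem memLp_linSecondDeriv {D φ : ℝ → ℝ} (u : linDomain D φ) :
    MemLp (linSecondDeriv u) 2 volume :=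
  (linSecondDeriv_spec u).2.1

theorem linSecondDeriv_eq {D φ : ℝ → ℝ} (u : linDomain D φ) {v : ℝ → ℂ}
    (hv : IsH2WithSecondDeriv (diffMul D φ u.1) v) : linSecondDeriv u =ᵐ[volume] v :=
  (linSecondDeriv_spec u).unique hv

/-- The linearization `𝓛 u = (D(φ) u)_xx + f'(φ) u` around the front `φ`, an unbounded operator in
`L²(ℝ)` with domain `{u ∈ L²(ℝ) : D(φ) u ∈ H²(ℝ)}`. The hypotheses are only used to see that
`f'(φ)` is bounded and measurable. -/
noncomputable def linearizedOp {D f φ : ℝ → ℝ} {α : ℝ} (hf : IsBistable f α)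
    (hφ : IsStationaryFront D f φ) : L2 →ₗ.[ℂ] L2 where
  domain := linDomain D φ
  toFun :=
    { toFun := fun u => (memLp_linSecondDeriv u).toLp + (memLp_reactMul hf hφ u.1).toLp
      map_add' := by
        intro u v
        rw [add_add_add_comm,
          ← MemLp.toLp_add (memLp_linSecondDeriv u) (memLp_linSecondDeriv v),
          ← MemLp.toLp_add (memLp_reactMul hf hφ u.1) (memLp_reactMul hf hφ v.1)]
        refine congrArg₂ (fun a b : L2 => a + b) ?_ ?_
        · rw [MemLp.toLp_eq_toLp_iff]
          exact linSecondDeriv_eq _ (((linSecondDeriv_spec u).add (linSecondDeriv_spec v)).congr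
            (diffMul_add_ae D φ u.1 v.1) .rfl)
        · rw [MemLp.toLp_eq_toLp_iff]
          filter_upwards [Lp.coeFn_add u.1 v.1] with x hx
          simp only [reactMul, Pi.add_apply, Submodule.coe_add, hx, mul_add]
      map_smul' := by
        intro c u
        rw [RingHom.id_apply, smul_add, ← MemLp.toLp_const_smul, ← MemLp.toLp_const_smul]
        refine congrArg₂ (fun a b : L2 => a + b) ?_ ?_
        · rw [MemLp.toLp_eq_toLp_iff]
          exact linSecondDeriv_eq _ (((linSecondDeriv_spec u).const_smul c).congr
            (diffMul_smul_ae D φ c u.1) .rfl)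
        · rw [MemLp.toLp_eq_toLp_iff]
          filter_upwards [Lp.coeFn_smul c u.1] with x hx
          simp only [reactMul, Pi.smul_apply, Submodule.coe_smul, smul_eq_mul, hx,
            mul_left_comm] }

theorem linearizedOp_eq_iff {D f φ : ℝ → ℝ} {α : ℝ} (hf : IsBistable f α)
    (hφ : IsStationaryFront D f φ) (u : (linearizedOp hf hφ).domain) (v : L2) :
    linearizedOp hf hφ u = v ↔
      IsH2WithSecondDeriv (diffMul D φ u.1) (⇑v - reactMul f φ u.1) := by
  have key : linearizedOp hf hφ u =
      (memLp_linSecondDeriv u).toLp + (memLp_reactMul hf hφ u.1).toLp := rfl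
  have h1 := Lp.coeFn_add ((memLp_linSecondDeriv u).toLp) ((memLp_reactMul hf hφ u.1).toLp)
  have h2 := (memLp_linSecondDeriv u).coeFn_toLp
  have h3 := (memLp_reactMul hf hφ u.1).coeFn_toLp
  rw [key]
  constructor
  · rintro rfl
    refine (linSecondDeriv_spec u).congr .rfl ?_
    filter_upwards [h1, h2, h3] with x h1 h2 h3
    rw [Pi.sub_apply, h1, Pi.add_apply, h2, h3]
    ring
  · intro h
    apply Lp.ext
    filter_upwards [h1, h2, h3, linSecondDeriv_eq u h] with x h1 h2 h3 h4
    rw [h1, Pi.add_apply, h2, h3, h4, Pi.sub_apply]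
    ring

/-! ### Eigenvalues of unbounded operators -/

section Eigen

variable {E : Type*} [AddCommGroup E] [Module ℂ E]

/-- The map `T - z` on the domain of `T`. -/
def shiftedMap (T : E →ₗ.[ℂ] E) (z : ℂ) : T.domain →ₗ[ℂ] E :=
  T.toFun - z • T.domain.subtype

/-- The point spectrum: the `z` for which `T - z` is not injective. -/
def pointSpectrum (T : E →ₗ.[ℂ] E) : Set ℂ :=
  {z | ¬ Function.Injective (shiftedMap T z)}

/-- `ker (T - z)ⁿ`, where the powers have their natural domains: `u ∈ ker (T - z)ⁿ⁺¹` if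
`u` is in the domain of `T` and `(T - z) u ∈ ker (T - z)ⁿ`. -/
def kerPow (T : E →ₗ.[ℂ] E) (z : ℂ) : ℕ → Submodule ℂ E
  | 0 => ⊥
  | n + 1 => ((kerPow T z n).comap (shiftedMap T z)).map T.domain.subtype

/-- The eigenspace `ker (T - z)`. -/
def eigenspaceAt (T : E →ₗ.[ℂ] E) (z : ℂ) : Submodule ℂ E :=
  (LinearMap.ker (shiftedMap T z)).map T.domain.subtype

/-- The generalized eigenspace `⋃ₙ ker (T - z)ⁿ` (an increasing union), that is, all elements of
Jordan chains at `z`. -/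
def genEigenspaceAt (T : E →ₗ.[ℂ] E) (z : ℂ) : Submodule ℂ E :=
  ⨆ n, kerPow T z n

/-- `z` is a simple eigenvalue: geometric and algebraic multiplicity are both one. -/
def IsSimpleEigenvalue (T : E →ₗ.[ℂ] E) (z : ℂ) : Prop :=
  z ∈ pointSpectrum T ∧ Module.finrank ℂ (eigenspaceAt T z) = 1 ∧
    Module.finrank ℂ (genEigenspaceAt T z) = 1

end Eigen

/-! ### Primitives and weak derivatives -/

/-! Write `P = D(φ) φ_x` for the flux and `G = frontPotential D f`. Since `P' = -f(φ)`, the first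
integral is `P² = G(φ)`, and the balance condition `∫ D f = 0` makes `G` vanish at both `0` and `1`
and be positive between them. Near `0`, `G` is bounded below by a multiple of `s³` while `D` is at
most linear, so `φ_x ≤ -c √φ`. Hence the front hits `0` at a finite edge `x₀` and stays there.

Let `𝓛 u = z u + c φ_x` and `W = D(φ) u`. Beyond the edge `D(φ) = 0`, so `W = 0` there. When `c = 0`
the equation there reduces to `(z - f'(0)) u = 0`, so apart from the negative number `z = f'(0)` an
eigenfunction is determined by `W` on `(-∞, x₀)`. There `W` is a classical solution of a singular
second-order equation, of which `P` is a solution for `z = c = 0` (`IsEdgeSolution`,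
`exists_isEdgeSolution`).

Everything rests on the Wronskian `q = P W' - P' W`. It satisfies `q' = φ_x (z W + c P)` and `(W/P)'
= q/P²`, and it vanishes at `-∞` and at `x₀`. Kernel (`z = c = 0`): `q` is constant, hence zero, so
`W` is a multiple of `P`. Jordan chains (`z = 0`): `q/c` would have the nonnegative derivative `φ_x
P = D(φ) φ_x²` and equal limits at the ends, so `c = 0`. Reality and sign (`c = 0`): `conj(W/P) q`
vanishes at both ends and has derivative `|q|²/P² + z |W|²/D(φ)`. Its imaginary and real parts force
`z` real and `z ≤ 0`.

The gap comes from a quantitative form of the kernel computation, with no compactness argument on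
eigenfunctions. Let `N = sup |W|` and `z ≠ 0`. Integrating `q'` from both ends gives `|q| ≤ 2|z|N
φ(1-φ)`. The function `(φ - α)/P` has derivative at least `κ φ(1-φ)/P²`, so comparison with `W/P`
yields `|W - kP| ≤ R` with `R = 2|z|N/κ`. The solvability relation `∫ φ_x W = 0` then bounds `|k|`
by a multiple of `R`. Altogether `N ≤ M|z|N` with `M` depending only on the front, and small `z ≠ 0`
forces `W = 0`. -/

theorem HasCompactSupport.exists_support_subset_Ioo {η : ℝ → ℝ} (hc : HasCompactSupport η) :
    ∃ R : ℝ, 0 < R ∧ tsupport η ⊆ Ioo (-R) R := by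
  obtain ⟨r, hr⟩ := (Metric.isBounded_iff_subset_ball (0 : ℝ)).1 hc.isCompact.isBounded
  refine ⟨max r 1, by positivity, hr.trans ?_⟩
  rw [Real.ball_eq_Ioo, zero_sub, zero_add]
  exact Ioo_subset_Ioo (neg_le_neg (le_max_left _ _)) (le_max_left _ _)

/-- A primitive of a locally integrable function is absolutely continuous on compact intervals and
has the integrand as derivative almost everywhere. Integrating by parts on an interval at whose end
points `η` vanishes leaves no boundary terms. -/
theorem integral_deriv_mul_primitive {g : ℝ → ℝ} (hg : LocallyIntegrable g volume) {η : ℝ → ℝ}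
    (h1 : ContDiff ℝ ∞ η) (h2 : HasCompactSupport η) :
    ∫ x, deriv η x * (∫ t in (0 : ℝ)..x, g t) = -∫ x, η x * g x := by
  obtain ⟨R, hR, hs⟩ := h2.exists_support_subset_Ioo
  have hsub : ∀ {h : ℝ → ℝ}, (∀ x, x ∉ tsupport η → h x = 0) →
      Function.support h ⊆ Ioc (-R) R := fun hh x hx =>
    Ioo_subset_Ioc_self (hs (by by_contra hn; exact hx (hh x hn)))
  have hη0 : ∀ x, x ∉ tsupport η → η x = 0 := fun x hx => image_eq_zero_of_notMem_tsupport hx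
  have hη1 : ∀ x, x ∉ tsupport η → deriv η x = 0 := fun x hx => by
    by_contra hn
    exact hx (support_deriv_subset hn)
  rw [← intervalIntegral.integral_eq_integral_of_support_subset
      (hsub fun x hx => by rw [hη1 x hx, zero_mul]),
    ← intervalIntegral.integral_eq_integral_of_support_subset
      (hsub fun x hx => by rw [hη0 x hx, zero_mul])]
  have hI : IntervalIntegrable g volume (-R) R := by
    rw [intervalIntegrable_iff]
    exact (hg.integrableOn_isCompact isCompact_uIcc).mono_set uIoc_subset_uIcc
  have hW := hI.absolutelyContinuousOnInterval_intervalIntegral (c := 0)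
    (by rw [uIcc_of_le (by linarith)]; constructor <;> linarith)
  have hη : AbsolutelyContinuousOnInterval η (-R) R :=
    (h1.of_le (by simp)).contDiffOn.absolutelyContinuousOnInterval
  have key := hW.integral_mul_deriv_eq_deriv_mul hη
  have e1 : η R = 0 := hη0 R fun h => lt_irrefl _ (hs h).2
  have e2 : η (-R) = 0 := hη0 (-R) fun h => lt_irrefl _ (hs h).1
  rw [e1, e2, mul_zero, mul_zero, sub_zero, zero_sub] at key
  simp_rw [mul_comm (deriv η _)]
  rw [key]
  congr 1
  refine intervalIntegral.integral_congr_ae ?_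
  filter_upwards [_root_.LocallyIntegrable.ae_hasDerivAt_integral hg] with x hx _
  rw [(hx 0).deriv, mul_comm]

theorem continuous_primitive_of_locallyIntegrable {v : ℝ → ℂ} (hv : LocallyIntegrable v volume) :
    Continuous fun x => ∫ t in (0 : ℝ)..x, v t :=
  intervalIntegral.continuous_primitive (fun a b => by
    rw [intervalIntegrable_iff]
    exact (hv.integrableOn_isCompact isCompact_uIcc).mono_set uIoc_subset_uIcc) 0

theorem isWeakDeriv_primitive {v : ℝ → ℂ} (hv : LocallyIntegrable v volume) :
    IsWeakDeriv (fun x => ∫ t in (0 : ℝ)..x, v t) v := by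
  intro η h1 h2
  have hII : ∀ a b, IntervalIntegrable v volume a b := fun a b => by
    rw [intervalIntegrable_iff]
    exact (hv.integrableOn_isCompact isCompact_uIcc).mono_set uIoc_subset_uIcc
  have hi1 : Integrable fun x => deriv η x • ∫ t in (0 : ℝ)..x, v t :=
    ((continuous_primitive_of_locallyIntegrable hv).locallyIntegrable
      ).integrable_smul_left_of_hasCompactSupport (h1.continuous_deriv (by simp)) h2.deriv
  have hi2 : Integrable fun x => η x • v x :=
    hv.integrable_smul_left_of_hasCompactSupport h1.continuous h2
  have key : ∀ L : ℂ →L[ℝ] ℝ, L (∫ x, deriv η x • ∫ t in (0 : ℝ)..x, v t) =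
      L (-∫ x, η x • v x) := by
    intro L
    have hL : LocallyIntegrable (fun x => L (v x)) volume := fun x => by
      obtain ⟨s, hs, hi⟩ := hv x
      exact ⟨s, hs, L.integrable_comp hi⟩
    rw [map_neg, ← L.integral_comp_comm hi1, ← L.integral_comp_comm hi2]
    simp only [map_smul, smul_eq_mul]
    rw [← integral_deriv_mul_primitive hL h1 h2]
    congr 1
    ext x
    rw [L.intervalIntegral_comp_comm (hII 0 x)]
  exact Complex.ext (key Complex.reCLM) (key Complex.imCLM)

/-- A compactly supported smooth function with vanishing integral is the derivative of a
compactly supported smooth function. -/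
theorem exists_deriv_eq_of_integral_eq_zero {η : ℝ → ℝ} (h1 : ContDiff ℝ ∞ η)
    (h2 : HasCompactSupport η) (h0 : ∫ x, η x = 0) :
    ∃ ζ : ℝ → ℝ, ContDiff ℝ ∞ ζ ∧ HasCompactSupport ζ ∧ deriv ζ = η := by
  obtain ⟨R, hR, hs⟩ := h2.exists_support_subset_Ioo
  have hη0 : ∀ x, x ∉ tsupport η → η x = 0 := fun x hx => image_eq_zero_of_notMem_tsupport hx
  set ζ : ℝ → ℝ := fun x => ∫ t in (-R)..x, η t with hζ
  have hd : ∀ x, HasDerivAt ζ (η x) x := fun x =>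
    h1.continuous.integral_hasStrictDerivAt (-R) x |>.hasDerivAt
  have hderiv : deriv ζ = η := funext fun x => (hd x).deriv
  refine ⟨ζ, ?_, ?_, hderiv⟩
  · exact contDiff_infty_iff_deriv.2 ⟨fun x => (hd x).differentiableAt, hderiv ▸ h1⟩
  · refine HasCompactSupport.intro (isCompact_Icc (a := -R) (b := R)) fun x hx => ?_
    rcases lt_or_ge x (-R) with h | h
    · refine intervalIntegral.integral_zero_ae (ae_of_all _ fun t ht => hη0 t fun hts => ?_)
      rw [uIoc_of_ge h.le] at ht
      linarith [(hs hts).1, ht.2]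
    · have hRx : R < x := by
        by_contra hn
        exact hx ⟨h, not_lt.1 hn⟩
      rw [hζ, ← h0]
      refine intervalIntegral.integral_eq_integral_of_support_subset fun t ht => ?_
      have : t ∈ tsupport η := subset_closure ht
      exact ⟨(hs this).1, (hs this).2.le.trans hRx.le⟩

/-- A locally integrable function with vanishing weak derivative is constant. -/
theorem IsWeakDeriv.ae_eq_const {w : ℝ → ℂ} (hw : LocallyIntegrable w volume)
    (h : IsWeakDeriv w 0) : ∃ c : ℂ, w =ᵐ[volume] fun _ => c := by
  -- The constant is the mean of `w` against a bump `ψ` of integral one. For any test function `η`,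
  -- the function `η - (∫ η) ψ` has integral zero, hence is the derivative of a test function, and
  -- `w` annihilates it.
  let η₀ : ContDiffBump (0 : ℝ) := ⟨1, 2, one_pos, one_lt_two⟩
  set ψ : ℝ → ℝ := η₀.normed volume with hψ
  have p1 : ContDiff ℝ ∞ ψ := η₀.contDiff_normed
  have p2 : HasCompactSupport ψ := η₀.hasCompactSupport_normed
  have p3 : ∫ x, ψ x = 1 := η₀.integral_normed
  refine ⟨∫ x, ψ x • w x, ae_eq_of_integral_contDiff_smul_eq hw
    (locallyIntegrable_const _) fun η h1 h2 => ?_⟩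
  have i1 : Integrable η := h1.continuous.integrable_of_hasCompactSupport h2
  have i2 : Integrable ψ := p1.continuous.integrable_of_hasCompactSupport p2
  have j1 : Integrable fun x => η x • w x :=
    hw.integrable_smul_left_of_hasCompactSupport h1.continuous h2
  have j2 : Integrable fun x => ψ x • w x :=
    hw.integrable_smul_left_of_hasCompactSupport p1.continuous p2
  set c : ℝ := ∫ x, η x with hc
  obtain ⟨ζ, z1, z2, z3⟩ := exists_deriv_eq_of_integral_eq_zero (η := fun x => η x - c * ψ x)
    (h1.sub (contDiff_const.mul p1)) (h2.sub (p2.mul_left (f' := ψ) (f := fun _ => c)))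
    (by rw [integral_sub i1 (i2.const_mul c), integral_const_mul, p3, mul_one, hc, sub_self])
  have := h ζ z1 z2
  rw [z3] at this
  simp only [sub_smul, mul_smul, Pi.zero_apply, smul_zero, integral_zero, neg_zero] at this
  rw [integral_sub (g := fun x => c • ψ x • w x) j1 (j2.smul c), integral_smul, sub_eq_zero] at this
  rw [this, integral_smul_const]

theorem IsWeakDeriv.exists_ae_eq_primitive {w v : ℝ → ℂ} (h : IsWeakDeriv w v)
    (hw : LocallyIntegrable w volume) (hv : LocallyIntegrable v volume) :
    ∃ c : ℂ, w =ᵐ[volume] fun x => c + ∫ t in (0 : ℝ)..x, v t := by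
  have hP := (continuous_primitive_of_locallyIntegrable hv).locallyIntegrable (μ := volume)
  obtain ⟨c, hc⟩ := IsWeakDeriv.ae_eq_const (hw.sub hP) (by
    intro η h1 h2
    have hd : Continuous (deriv η) := h1.continuous_deriv (by simp)
    simp only [Pi.sub_apply, smul_sub, Pi.zero_apply, smul_zero, integral_zero, neg_zero]
    rw [integral_sub (hw.integrable_smul_left_of_hasCompactSupport hd h2.deriv)
      (hP.integrable_smul_left_of_hasCompactSupport hd h2.deriv), h η h1 h2,
      isWeakDeriv_primitive hv η h1 h2, sub_self])
  refine ⟨c, ?_⟩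
  filter_upwards [hc] with x hx
  rw [← hx, Pi.sub_apply]
  ring

/-- Functions in `H²(ℝ)` have a `C¹` representative whose derivative is a primitive of the second
weak derivative. -/
theorem IsH2WithSecondDeriv.exists_representative {w v : ℝ → ℂ} (h : IsH2WithSecondDeriv w v) :
    ∃ (W W₁ : ℝ → ℂ) (c : ℂ), w =ᵐ[volume] W ∧ (∀ x, HasDerivAt W (W₁ x) x) ∧
      (∀ x, W₁ x = c + ∫ t in (0 : ℝ)..x, v t) ∧ Continuous W₁ ∧
      MemLp W 2 volume ∧ MemLp W₁ 2 volume := by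
  obtain ⟨hw, hv, w₁, hw₁, d1, d2⟩ := h
  have lw := hw.locallyIntegrable (by norm_num)
  have lv := hv.locallyIntegrable (by norm_num)
  have lw₁ := hw₁.locallyIntegrable (by norm_num)
  obtain ⟨c, hc⟩ := d2.exists_ae_eq_primitive lw₁ lv
  set W₁ : ℝ → ℂ := fun x => c + ∫ t in (0 : ℝ)..x, v t with hW₁
  have hcont : Continuous W₁ :=
    continuous_const.add (continuous_primitive_of_locallyIntegrable lv)
  obtain ⟨k, hk⟩ := (d1.congr .rfl hc).exists_ae_eq_primitive lw hcont.locallyIntegrable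
  refine ⟨fun x => k + ∫ t in (0 : ℝ)..x, W₁ t, W₁, c, hk, fun x => ?_, fun x => rfl, hcont,
    (memLp_congr_ae hk).1 hw, (memLp_congr_ae hc).1 hw₁⟩
  exact (hcont.integral_hasStrictDerivAt 0 x).hasDerivAt.const_add k

/-- A classical derivative is a weak derivative. -/
theorem IsWeakDeriv.of_hasDerivAt {w v : ℝ → ℂ} (hd : ∀ x, HasDerivAt w (v x) x)
    (hv : LocallyIntegrable v volume) : IsWeakDeriv w v := by
  intro η h1 h2
  have hw : LocallyIntegrable w volume :=
    (continuous_iff_continuousAt.2 fun x => (hd x).continuousAt).locallyIntegrable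
  have hc : Continuous (deriv η) := h1.continuous_deriv (by simp)
  have := integral_bilinear_hasDerivAt_right_eq_neg_left_of_integrable
    (L := ContinuousLinearMap.lsmul ℝ ℝ (E := ℂ)) (u := η) (u' := deriv η) (v := w) (v' := v)
    (fun x _ => (h1.differentiable (by simp) x).hasDerivAt) (fun x _ => hd x)
    (hv.integrable_smul_left_of_hasCompactSupport h1.continuous h2)
    (hw.integrable_smul_left_of_hasCompactSupport hc h2.deriv)
    (hw.integrable_smul_left_of_hasCompactSupport h1.continuous h2)
  simp only [ContinuousLinearMap.lsmul_apply] at this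
  rw [this, neg_neg]

/-! ### Calculus on the unit interval -/

theorem monotoneOn_Icc_of_hasDerivAt {a b : ℝ} {g g' : ℝ → ℝ} (hc : ContinuousOn g (Icc a b))
    (hd : ∀ x ∈ Ioo a b, HasDerivAt g (g' x) x) (hn : ∀ x ∈ Ioo a b, 0 ≤ g' x) :
    MonotoneOn g (Icc a b) :=
  monotoneOn_of_hasDerivWithinAt_nonneg (convex_Icc a b) hc
    (fun x hx => (hd x (by rwa [interior_Icc] at hx)).hasDerivWithinAt)
    (fun x hx => hn x (by rwa [interior_Icc] at hx))

section UnitInterval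

variable {g : ℝ → ℝ}

theorem ContDiffOn.hasDerivWithinAt_unit (hg : ContDiffOn ℝ 2 g (Icc 0 1)) {s : ℝ}
    (hs : s ∈ Icc (0 : ℝ) 1) : HasDerivWithinAt g (derivWithin g (Icc 0 1) s) (Icc 0 1) s :=
  (hg.differentiableOn (by norm_num) s hs).hasDerivWithinAt

theorem ContDiffOn.hasDerivAt_unit (hg : ContDiffOn ℝ 2 g (Icc 0 1)) {s : ℝ}
    (hs : s ∈ Ioo (0 : ℝ) 1) : HasDerivAt g (derivWithin g (Icc 0 1) s) s :=
  (hg.hasDerivWithinAt_unit (Ioo_subset_Icc_self hs)).hasDerivAt (Icc_mem_nhds hs.1 hs.2)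

theorem ContDiffOn.continuousOn_derivWithin_unit (hg : ContDiffOn ℝ 2 g (Icc 0 1)) :
    ContinuousOn (derivWithin g (Icc 0 1)) (Icc 0 1) :=
  hg.continuousOn_derivWithin (uniqueDiffOn_Icc zero_lt_one) (by norm_num)

theorem ContDiffOn.exists_abs_sub_le_unit (hg : ContDiffOn ℝ 2 g (Icc 0 1)) :
    ∃ L : ℝ, 0 < L ∧ ∀ s ∈ Icc (0 : ℝ) 1, ∀ t ∈ Icc (0 : ℝ) 1, |g s - g t| ≤ L * |s - t| := by
  obtain ⟨K, hK⟩ := hg.exists_lipschitzOnWith (by norm_num) (convex_Icc _ _) isCompact_Icc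
  refine ⟨K + 1, by positivity, fun s hs t ht => ?_⟩
  have := hK.dist_le_mul s hs t ht
  rw [Real.dist_eq, Real.dist_eq] at this
  nlinarith [abs_nonneg (s - t)]

end UnitInterval

/-! ### Bounds for `D` and `f` near their zeros -/

section Coefficients

variable {D f : ℝ → ℝ} {α : ℝ}

theorem IsDegenerateDiffusivity.exists_le_deriv (hD : IsDegenerateDiffusivity D) :
    ∃ d : ℝ, 0 < d ∧ ∀ s ∈ Icc (0 : ℝ) 1, d ≤ derivWithin D (Icc 0 1) s := by
  obtain ⟨s, hs, hm⟩ := isCompact_Icc.exists_isMinOn (nonempty_Icc.2 zero_le_one)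
    hD.contDiffOn.continuousOn_derivWithin_unit
  exact ⟨_, hD.deriv_pos s hs, fun t ht => hm ht⟩

theorem IsDegenerateDiffusivity.nonneg (hD : IsDegenerateDiffusivity D) {s : ℝ}
    (hs : s ∈ Icc (0 : ℝ) 1) : 0 ≤ D s := by
  rcases hs.1.eq_or_lt with h | h
  · rw [← h, hD.map_zero]
  · exact (hD.pos s ⟨h, hs.2⟩).le

theorem IsDegenerateDiffusivity.exists_mul_le (hD : IsDegenerateDiffusivity D) :
    ∃ d : ℝ, 0 < d ∧ ∀ s ∈ Icc (0 : ℝ) 1, d * s ≤ D s := by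
  obtain ⟨d, hd, hle⟩ := hD.exists_le_deriv
  refine ⟨d, hd, fun s hs => ?_⟩
  have hm : MonotoneOn (fun t => D t - d * t) (Icc 0 1) :=
    monotoneOn_Icc_of_hasDerivAt (g' := fun t => derivWithin D (Icc 0 1) t - d * 1)
      (hD.contDiffOn.continuousOn.sub (by fun_prop))
      (fun x hx => (hD.contDiffOn.hasDerivAt_unit hx).sub ((hasDerivAt_id x).const_mul d))
      (fun x hx => by linarith [hle x (Ioo_subset_Icc_self hx)])
  have := hm (left_mem_Icc.2 zero_le_one) hs hs.1
  simp only [hD.map_zero] at this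
  linarith

theorem IsDegenerateDiffusivity.exists_le_mul (hD : IsDegenerateDiffusivity D) :
    ∃ L : ℝ, 0 < L ∧ ∀ s ∈ Icc (0 : ℝ) 1, D s ≤ L * s := by
  obtain ⟨L, hL, h⟩ := hD.contDiffOn.exists_abs_sub_le_unit
  refine ⟨L, hL, fun s hs => ?_⟩
  have := h s hs 0 (left_mem_Icc.2 zero_le_one)
  rw [hD.map_zero, sub_zero, sub_zero, abs_of_nonneg hs.1] at this
  exact (le_abs_self _).trans this

theorem IsBistable.exists_abs_le (hf : IsBistable f α) :
    ∃ L : ℝ, 0 < L ∧ ∀ s ∈ Icc (0 : ℝ) 1, |f s| ≤ L * s ∧ |f s| ≤ L * (1 - s) ∧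
      |f s| ≤ L * (s * (1 - s)) := by
  obtain ⟨L, hL, h⟩ := hf.contDiffOn.exists_abs_sub_le_unit
  -- The factor `2` serves the product bound: on each half of the interval one of `s`, `1 - s` is at
  -- least `1/2`.
  refine ⟨2 * L, by positivity, fun s hs => ?_⟩
  have h0 := h s hs 0 (left_mem_Icc.2 zero_le_one)
  have h1 := h s hs 1 (right_mem_Icc.2 zero_le_one)
  rw [hf.map_zero, sub_zero, sub_zero, abs_of_nonneg hs.1] at h0
  rw [hf.map_one, sub_zero, abs_sub_comm s, abs_of_nonneg (sub_nonneg.2 hs.2)] at h1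
  have a1 := hs.1
  have a2 := hs.2
  refine ⟨by nlinarith, by nlinarith, ?_⟩
  rcases le_total s (1 / 2) with h' | h'
  · have : 0 ≤ L * s * (1 - 2 * s) := by
      have : 0 ≤ 1 - 2 * s := by linarith
      positivity
    nlinarith
  · have : 0 ≤ L * (1 - s) * (2 * s - 1) := by
      have : 0 ≤ 2 * s - 1 := by linarith
      have : 0 ≤ 1 - s := by linarith
      positivity
    nlinarith

/-- Linear bounds for a bistable reaction near its two stable zeros. -/
theorem IsBistable.exists_linear_bounds (hf : IsBistable f α) :
    ∃ ε c : ℝ, 0 < ε ∧ 0 < c ∧ ε < α ∧ α < 1 - ε ∧ (∀ s ∈ Icc 0 ε, f s ≤ -c * s) ∧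
      ∀ s ∈ Icc (1 - ε) 1, c * (1 - s) ≤ f s := by
  -- Close to each end point the difference quotients of `f` lie below half of the negative
  -- one-sided derivative.
  have h0 := (hf.contDiffOn.hasDerivWithinAt_unit (left_mem_Icc.2 zero_le_one)).limsup_slope_le
    (r := derivWithin f (Icc 0 1) 0 / 2) (by linarith [hf.deriv_zero_neg])
  have h1 := (hf.contDiffOn.hasDerivWithinAt_unit (right_mem_Icc.2 zero_le_one)).limsup_slope_le
    (r := derivWithin f (Icc 0 1) 1 / 2) (by linarith [hf.deriv_one_neg])
  obtain ⟨ε₀, e0, h0⟩ := Metric.eventually_nhds_iff.1 (eventually_nhdsWithin_iff.1 h0)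
  obtain ⟨ε₁, e1, h1⟩ := Metric.eventually_nhds_iff.1 (eventually_nhdsWithin_iff.1 h1)
  have ha := hf.mem_Ioo
  have n0 := hf.deriv_zero_neg
  have n1 := hf.deriv_one_neg
  set a := derivWithin f (Icc 0 1) 0
  set b := derivWithin f (Icc 0 1) 1
  obtain ⟨ε, hε, hε'⟩ : ∃ ε, 0 < ε ∧ ε < min (min ε₀ ε₁) (min α (1 - α)) :=
    exists_between (by
      simp only [lt_min_iff]
      exact ⟨⟨e0, e1⟩, ha.1, by linarith [ha.2]⟩)
  simp only [lt_min_iff] at hε'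
  obtain ⟨⟨l0, l1⟩, l2, l3⟩ := hε'
  have hc : 0 < min (-a / 2) (-b / 2) := lt_min (by linarith) (by linarith)
  refine ⟨ε, min (-a / 2) (-b / 2), hε, hc, l2, by linarith, fun s hs => ?_, fun s hs => ?_⟩
  · rcases hs.1.eq_or_lt with h | h
    · rw [← h, hf.map_zero, mul_zero]
    · have := h0 (y := s) (by rw [Real.dist_eq, sub_zero, abs_of_pos h]; linarith [hs.2])
        ⟨⟨h.le, by linarith [hs.2, ha.2]⟩, h.ne'⟩
      rw [slope_def_field, hf.map_zero, sub_zero, sub_zero, div_lt_iff₀ h] at this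
      nlinarith [min_le_left (-a / 2) (-b / 2)]
  · rcases hs.2.eq_or_lt with h | h
    · rw [h, hf.map_one, sub_self, mul_zero]
    · have := h1 (y := s) (by rw [Real.dist_eq, abs_sub_comm, abs_of_pos (by linarith)]
                              linarith [hs.1])
        ⟨⟨by linarith [hs.1, ha.1], h.le⟩, h.ne⟩
      rw [slope_def_field, hf.map_one, sub_zero, div_lt_iff_of_neg (by linarith)] at this
      nlinarith [min_le_right (-a / 2) (-b / 2)]

/-! ### The potential of the first integral -/

/-- `G(s) = -2 ∫₀ˢ D f`, with the integrand extended by constants outside `[0,1]`. -/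
noncomputable def frontPotential (D f : ℝ → ℝ) (s : ℝ) : ℝ :=
  -2 * ∫ t in (0 : ℝ)..s, IccExtend zero_le_one (fun r : Icc (0 : ℝ) 1 => D r * f r) t

theorem hasDerivAt_frontPotential (hD : IsDegenerateDiffusivity D) (hf : IsBistable f α) {s : ℝ}
    (hs : s ∈ Icc (0 : ℝ) 1) : HasDerivAt (frontPotential D f) (-2 * (D s * f s)) s := by
  have hc : Continuous (IccExtend zero_le_one (fun r : Icc (0 : ℝ) 1 => D r * f r)) :=
    ((hD.contDiffOn.continuousOn.mul hf.contDiffOn.continuousOn).domRestrict).Icc_extend'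
  have := (hc.integral_hasStrictDerivAt 0 s).hasDerivAt.const_mul (-2)
  rwa [IccExtend_of_mem zero_le_one (fun r : Icc (0 : ℝ) 1 => D r * f r) hs] at this

theorem continuousOn_frontPotential (hD : IsDegenerateDiffusivity D) (hf : IsBistable f α) :
    ContinuousOn (frontPotential D f) (Icc 0 1) := fun _ hs =>
  (hasDerivAt_frontPotential hD hf hs).continuousAt.continuousWithinAt

theorem frontPotential_zero (D f : ℝ → ℝ) : frontPotential D f 0 = 0 := by
  simp [frontPotential]

theorem frontPotential_one (hDf : ∫ u in (0 : ℝ)..1, D u * f u = 0) :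
    frontPotential D f 1 = 0 := by
  have : ∫ t in (0 : ℝ)..1, IccExtend zero_le_one (fun r : Icc (0 : ℝ) 1 => D r * f r) t =
      ∫ u in (0 : ℝ)..1, D u * f u := by
    refine intervalIntegral.integral_congr fun t ht => ?_
    rw [uIcc_of_le zero_le_one] at ht
    exact IccExtend_of_mem zero_le_one (fun r : Icc (0 : ℝ) 1 => D r * f r) ht
  rw [frontPotential, this, hDf, mul_zero]

/-- As `G' = -2 D f`, the potential increases from `G(0) = 0` up to `α` and decreases from there to
`G(1) = 0`. -/
theorem frontPotential_pos (hD : IsDegenerateDiffusivity D) (hf : IsBistable f α)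
    (hDf : ∫ u in (0 : ℝ)..1, D u * f u = 0) {s : ℝ} (hs : s ∈ Ioo (0 : ℝ) 1) :
    0 < frontPotential D f s := by
  have ha := hf.mem_Ioo
  rcases le_total s α with h | h
  · have : StrictMonoOn (frontPotential D f) (Icc 0 α) :=
      strictMonoOn_of_deriv_pos (convex_Icc _ _)
        ((continuousOn_frontPotential hD hf).mono (Icc_subset_Icc_right ha.2.le)) fun t ht => by
          rw [interior_Icc] at ht
          have ht1 : t < 1 := ht.2.trans ha.2
          rw [(hasDerivAt_frontPotential hD hf ⟨ht.1.le, ht1.le⟩).deriv]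
          nlinarith [mul_pos (hD.pos t ⟨ht.1, ht1.le⟩) (neg_pos.2 (hf.neg t ht))]
    have := this (left_mem_Icc.2 ha.1.le) ⟨hs.1.le, h⟩ hs.1
    rwa [frontPotential_zero] at this
  · have : StrictAntiOn (frontPotential D f) (Icc α 1) :=
      strictAntiOn_of_deriv_neg (convex_Icc _ _)
        ((continuousOn_frontPotential hD hf).mono (Icc_subset_Icc_left ha.1.le)) fun t ht => by
          rw [interior_Icc] at ht
          have ht0 : 0 < t := ha.1.trans ht.1
          rw [(hasDerivAt_frontPotential hD hf ⟨ht0.le, ht.2.le⟩).deriv]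
          nlinarith [mul_pos (hD.pos t ⟨ht0, ht.2.le⟩) (hf.pos t ht)]
    have := this ⟨h, hs.2.le⟩ (right_mem_Icc.2 ha.2.le) hs.2
    rwa [frontPotential_one hDf] at this

theorem frontPotential_nonneg (hD : IsDegenerateDiffusivity D) (hf : IsBistable f α)
    (hDf : ∫ u in (0 : ℝ)..1, D u * f u = 0) {s : ℝ} (hs : s ∈ Icc (0 : ℝ) 1) :
    0 ≤ frontPotential D f s := by
  rcases hs.1.eq_or_lt with h | h
  · rw [← h, frontPotential_zero]
  rcases hs.2.eq_or_lt with h' | h'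
  · rw [h', frontPotential_one hDf]
  exact (frontPotential_pos hD hf hDf ⟨h, h'⟩).le

/-- The derivative `2 (L/d) D D'` of `(L/d) D²` dominates `G' = -2 D f`, since `D' ≥ d` and `f ≥
-L`. With `P² = G(φ)` this bounds `φ_x` up to the edge. -/
theorem exists_frontPotential_le_sq (hD : IsDegenerateDiffusivity D) (hf : IsBistable f α) :
    ∃ C : ℝ, 0 < C ∧ ∀ s ∈ Icc (0 : ℝ) 1, frontPotential D f s ≤ C * D s ^ 2 := by
  obtain ⟨d, hd, hle⟩ := hD.exists_le_deriv
  obtain ⟨L, hL, hfL⟩ := hf.exists_abs_le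
  refine ⟨L / d, by positivity, fun s hs => ?_⟩
  have hm : MonotoneOn (fun t => L / d * D t ^ 2 - frontPotential D f t) (Icc 0 1) :=
    monotoneOn_Icc_of_hasDerivAt
      (g' := fun t => L / d * (2 * D t ^ (2 - 1) * derivWithin D (Icc 0 1) t) -
        (-2 * (D t * f t)))
      ((continuousOn_const.mul (hD.contDiffOn.continuousOn.pow 2)).sub
        (continuousOn_frontPotential hD hf))
      (fun x hx => (((hD.contDiffOn.hasDerivAt_unit hx).pow 2).const_mul _).sub
        (hasDerivAt_frontPotential hD hf (Ioo_subset_Icc_self hx)))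
      (fun x hx => by
        have hx' := Ioo_subset_Icc_self hx
        have h1 : L ≤ L / d * derivWithin D (Icc 0 1) x := by
          rw [div_mul_eq_mul_div, le_div_iff₀ hd]
          exact mul_le_mul_of_nonneg_left (hle x hx') hL.le
        have h2 : -L ≤ f x := by
          have := (hfL x hx').1
          have := neg_abs_le (f x)
          nlinarith [hx.2]
        have h3 := hD.nonneg hx'
        have : 0 ≤ 2 * D x * (L / d * derivWithin D (Icc 0 1) x + f x) := by
          apply mul_nonneg (by positivity)
          linarith
        simp only [Nat.add_one_sub_one, pow_one]
        linarith)
  have := hm (left_mem_Icc.2 zero_le_one) hs hs.1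
  simp only [hD.map_zero, frontPotential_zero] at this
  linarith

/-- `G` vanishes at `1` and `D f` is at most linear in `1 - s`, so integrating back from `1` gives a
quadratic bound. -/
theorem exists_frontPotential_le_one_sub_sq (hD : IsDegenerateDiffusivity D)
    (hf : IsBistable f α) (hDf : ∫ u in (0 : ℝ)..1, D u * f u = 0) :
    ∃ C : ℝ, 0 < C ∧ ∀ s ∈ Icc (0 : ℝ) 1, frontPotential D f s ≤ C * (1 - s) ^ 2 := by
  obtain ⟨M, hM, hDM⟩ := hD.exists_le_mul
  obtain ⟨L, hL, hfL⟩ := hf.exists_abs_le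
  refine ⟨M * L, by positivity, fun s hs => ?_⟩
  have hm : MonotoneOn (fun t => frontPotential D f t - M * L * (1 - t) ^ 2) (Icc 0 1) :=
    monotoneOn_Icc_of_hasDerivAt
      (g' := fun t => -2 * (D t * f t) - M * L * (2 * (1 - t) ^ (2 - 1) * (-1)))
      ((continuousOn_frontPotential hD hf).sub (by fun_prop))
      (fun x hx => (hasDerivAt_frontPotential hD hf (Ioo_subset_Icc_self hx)).sub
        ((((hasDerivAt_id x).const_sub 1).pow 2).const_mul _))
      (fun x hx => by
        have hx' := Ioo_subset_Icc_self hx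
        have h1 : D x ≤ M := (hDM x hx').trans (by nlinarith [hx.2])
        have h2 := (le_abs_self _).trans (hfL x hx').2.1
        have h3 := hD.nonneg hx'
        have h4 : D x * f x ≤ M * (L * (1 - x)) :=
          (mul_le_mul_of_nonneg_left h2 h3).trans
            (mul_le_mul_of_nonneg_right h1 (mul_nonneg hL.le (by linarith [hx.2])))
        simp only [Nat.add_one_sub_one, pow_one]
        linarith)
  have := hm hs (right_mem_Icc.2 zero_le_one) hs.2
  simp only [frontPotential_one hDf, sub_self] at this
  linarith

/-- Near `0` both `D` and `-f` are at least linear, hence `G' ≥ c s²` and `G` is at least cubic.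
Near `1`, `D` stays away from zero and `f` is at least linear in `1 - s`, hence the square.
Compactness covers the middle. The exponent `3` is what produces a finite edge. -/
theorem exists_le_frontPotential (hD : IsDegenerateDiffusivity D) (hf : IsBistable f α)
    (hDf : ∫ u in (0 : ℝ)..1, D u * f u = 0) :
    ∃ c : ℝ, 0 < c ∧ ∀ s ∈ Icc (0 : ℝ) 1, c * (s ^ 3 * (1 - s) ^ 2) ≤ frontPotential D f s := by
  obtain ⟨d, hd, hDd⟩ := hD.exists_mul_le
  obtain ⟨ε, c, hε, hc, hεα, hα, hf0, hf1⟩ := hf.exists_linear_bounds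
  have ha := hf.mem_Ioo
  have hmid : Icc ε (1 - ε) ⊆ Icc 0 1 := Icc_subset_Icc hε.le (by linarith)
  obtain ⟨r, hr, hmin⟩ := isCompact_Icc.exists_isMinOn (nonempty_Icc.2 (by linarith : ε ≤ 1 - ε))
    ((continuousOn_frontPotential hD hf).mono hmid)
  have hm : 0 < frontPotential D f r :=
    frontPotential_pos hD hf hDf ⟨hε.trans_le hr.1, by linarith [hr.2]⟩
  have near0 : ∀ s ∈ Icc 0 ε, d * c / 2 * s ^ 3 ≤ frontPotential D f s := by
    intro s hs
    have hmo : MonotoneOn (fun t => frontPotential D f t - d * c / 2 * t ^ 3) (Icc 0 ε) :=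
      monotoneOn_Icc_of_hasDerivAt
        (g' := fun t => -2 * (D t * f t) - d * c / 2 * (3 * t ^ (3 - 1) * 1))
        (((continuousOn_frontPotential hD hf).mono (Icc_subset_Icc_right (by linarith))).sub
          (by fun_prop))
        (fun x hx => (hasDerivAt_frontPotential hD hf ⟨hx.1.le, by linarith [hx.2]⟩).sub
          (((hasDerivAt_id x).pow 3).const_mul _))
        (fun x hx => by
          have h1 := hDd x ⟨hx.1.le, by linarith [hx.2]⟩
          have h2 := hf0 x ⟨hx.1.le, hx.2.le⟩
          have h3 : d * x * (c * x) ≤ D x * (-f x) :=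
            mul_le_mul h1 (by linarith) (mul_nonneg hc.le hx.1.le)
              ((mul_nonneg hd.le hx.1.le).trans h1)
          have h4 : 0 ≤ d * c * x ^ 2 := by positivity
          simp only [Nat.add_one_sub_one, mul_one]
          nlinarith)
    have := hmo (left_mem_Icc.2 hε.le) hs hs.1
    simp only [frontPotential_zero] at this
    linarith
  have near1 : ∀ s ∈ Icc (1 - ε) 1, d * α * c * (1 - s) ^ 2 ≤ frontPotential D f s := by
    intro s hs
    have hmo : MonotoneOn (fun t => d * α * c * (1 - t) ^ 2 - frontPotential D f t)
        (Icc (1 - ε) 1) :=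
      monotoneOn_Icc_of_hasDerivAt
        (g' := fun t => d * α * c * (2 * (1 - t) ^ (2 - 1) * (-1)) - -2 * (D t * f t))
        (ContinuousOn.sub (by fun_prop)
          ((continuousOn_frontPotential hD hf).mono (Icc_subset_Icc_left (by linarith))))
        (fun x hx => ((((hasDerivAt_id x).const_sub 1).pow 2).const_mul _).sub
          (hasDerivAt_frontPotential hD hf ⟨by linarith [hx.1], hx.2.le⟩))
        (fun x hx => by
          have h1 := hDd x ⟨by linarith [hx.1], hx.2.le⟩
          have h1' : d * α ≤ D x := le_trans (by nlinarith [hx.1]) h1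
          have h2 := hf1 x ⟨hx.1.le, hx.2.le⟩
          have h0 : 0 ≤ 1 - x := by linarith [hx.2]
          have h3 : d * α * (c * (1 - x)) ≤ D x * f x :=
            mul_le_mul h1' h2 (by positivity) ((mul_nonneg hd.le ha.1.le).trans h1')
          simp only [Nat.add_one_sub_one, pow_one]
          nlinarith)
    have := hmo hs (right_mem_Icc.2 (by linarith)) hs.2
    simp only [frontPotential_one hDf, sub_self] at this
    linarith
  have hα0 := ha.1
  refine ⟨min (frontPotential D f r) (min (d * c / 2) (d * α * c)),
    lt_min hm (lt_min (by positivity) (by positivity)), fun s hs => ?_⟩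
  set k := min (frontPotential D f r) (min (d * c / 2) (d * α * c)) with hk
  have k1 : k ≤ frontPotential D f r := min_le_left _ _
  have k2 : k ≤ d * c / 2 := (min_le_right _ _).trans (min_le_left _ _)
  have k3 : k ≤ d * α * c := (min_le_right _ _).trans (min_le_right _ _)
  have s0 := hs.1
  have s1 : 0 ≤ 1 - s := sub_nonneg.2 hs.2
  have p3 : s ^ 3 ≤ 1 := pow_le_one₀ s0 hs.2
  have p2 : (1 - s) ^ 2 ≤ 1 := pow_le_one₀ s1 (by linarith)
  have q3 : 0 ≤ s ^ 3 := by positivity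
  have q2 : 0 ≤ (1 - s) ^ 2 := by positivity
  have r1 : s ^ 3 * (1 - s) ^ 2 ≤ s ^ 3 := mul_le_of_le_one_right q3 p2
  have r2 : s ^ 3 * (1 - s) ^ 2 ≤ (1 - s) ^ 2 := mul_le_of_le_one_left q2 p3
  have r0 : 0 ≤ s ^ 3 * (1 - s) ^ 2 := mul_nonneg q3 q2
  rcases le_total s ε with h | h
  · exact (mul_le_mul k2 r1 r0 (by positivity)).trans (near0 s ⟨s0, h⟩)
  rcases le_total (1 - ε) s with h' | h'
  · exact (mul_le_mul k3 r2 r0 (by positivity)).trans (near1 s ⟨h', hs.2⟩)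
  · have : frontPotential D f r ≤ frontPotential D f s := hmin ⟨h, h'⟩
    refine le_trans ?_ this
    calc k * (s ^ 3 * (1 - s) ^ 2) ≤ frontPotential D f r * 1 :=
          mul_le_mul k1 (r1.trans p3) r0 hm.le
      _ = _ := mul_one _

/-- The inequality behind the spectral gap. -/
theorem exists_mul_le_frontPotential_div_add (hD : IsDegenerateDiffusivity D)
    (hf : IsBistable f α) (hDf : ∫ u in (0 : ℝ)..1, D u * f u = 0) :
    ∃ c : ℝ, 0 < c ∧ ∀ s ∈ Ioo (0 : ℝ) 1,
      c * (s * (1 - s)) ≤ frontPotential D f s / D s + (s - α) * f s := by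
  obtain ⟨ε, c, hε, hc, hεα, hα, hf0, hf1⟩ := hf.exists_linear_bounds
  have ha := hf.mem_Ioo
  have hmid : Icc ε (1 - ε) ⊆ Icc 0 1 := Icc_subset_Icc hε.le (by linarith)
  have hDpos : ∀ s ∈ Ioo (0 : ℝ) 1, 0 < D s := fun s hs => hD.pos s ⟨hs.1, hs.2.le⟩
  -- Both summands are nonnegative. Near the end points `(s - α) f` alone gives the linear bound; in
  -- between, `G/D` is positive, in particular at `α` where the other term vanishes.
  have hfnn : ∀ s ∈ Ioo (0 : ℝ) 1, 0 ≤ (s - α) * f s := by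
    intro s hs
    rcases lt_trichotomy s α with h | h | h
    · exact mul_nonneg_of_nonpos_of_nonpos (by linarith) (hf.neg s ⟨hs.1, h⟩).le
    · rw [h, sub_self, zero_mul]
    · exact mul_nonneg (by linarith) (hf.pos s ⟨h, hs.2⟩).le
  obtain ⟨r, hr, hmin⟩ := isCompact_Icc.exists_isMinOn (nonempty_Icc.2 (by linarith : ε ≤ 1 - ε))
    (f := fun s => frontPotential D f s / D s + (s - α) * f s)
    ((((continuousOn_frontPotential hD hf).mono hmid).div (hD.contDiffOn.continuousOn.mono hmid)
      (fun s hs => (hDpos s ⟨hε.trans_le hs.1, by linarith [hs.2]⟩).ne')).add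
      (ContinuousOn.mul (by fun_prop) (hf.contDiffOn.continuousOn.mono hmid)))
  have hr' : r ∈ Ioo (0 : ℝ) 1 := ⟨hε.trans_le hr.1, by linarith [hr.2]⟩
  have hm : 0 < frontPotential D f r / D r + (r - α) * f r :=
    add_pos_of_pos_of_nonneg (div_pos (frontPotential_pos hD hf hDf hr') (hDpos r hr'))
      (hfnn r hr')
  set m := frontPotential D f r / D r + (r - α) * f r
  have u1 : 0 < α - ε := by linarith
  have u2 : 0 < 1 - ε - α := by linarith
  refine ⟨min m (min (c * (α - ε)) (c * (1 - ε - α))),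
    lt_min hm (lt_min (by positivity) (by positivity)), fun s hs => ?_⟩
  set k := min m (min (c * (α - ε)) (c * (1 - ε - α))) with hk
  have k1 : k ≤ m := min_le_left _ _
  have k2 : k ≤ c * (α - ε) := (min_le_right _ _).trans (min_le_left _ _)
  have k3 : k ≤ c * (1 - ε - α) := (min_le_right _ _).trans (min_le_right _ _)
  have s0 := hs.1
  have s1 : 0 < 1 - s := sub_pos.2 hs.2
  have hG : 0 ≤ frontPotential D f s / D s :=
    (div_pos (frontPotential_pos hD hf hDf hs) (hDpos s hs)).le
  have r0 : 0 ≤ s * (1 - s) := by positivity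
  rcases le_total s ε with h | h
  · have h1 : k * (s * (1 - s)) ≤ c * (α - ε) * s :=
      mul_le_mul k2 (mul_le_of_le_one_right s0.le (by linarith)) r0 (by positivity)
    have h2 := hf0 s ⟨s0.le, h⟩
    have h3 : (α - ε) * (c * s) ≤ (α - s) * (-f s) :=
      mul_le_mul (by linarith) (by linarith) (by positivity) (by linarith)
    nlinarith
  rcases le_total (1 - ε) s with h' | h'
  · have h1 : k * (s * (1 - s)) ≤ c * (1 - ε - α) * (1 - s) :=
      mul_le_mul k3 (mul_le_of_le_one_left s1.le (by linarith)) r0 (by positivity)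
    have h2 := hf1 s ⟨h', hs.2.le⟩
    have h3 : (1 - ε - α) * (c * (1 - s)) ≤ (s - α) * f s :=
      mul_le_mul (by linarith) h2 (by positivity) (by linarith)
    nlinarith
  · have : m ≤ frontPotential D f s / D s + (s - α) * f s := hmin ⟨h, h'⟩
    refine le_trans ?_ this
    calc k * (s * (1 - s)) ≤ m * 1 := mul_le_mul k1 (by nlinarith) r0 hm.le
      _ = _ := mul_one _

end Coefficients

/-! ### Properties of the stationary front -/

/-- The flux `D(φ) φ_x` of the front. -/
noncomputable def frontFlux (D φ : ℝ → ℝ) (x : ℝ) : ℝ := D (φ x) * deriv φ x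

namespace IsStationaryFront

variable {D f φ : ℝ → ℝ} {α : ℝ}

theorem continuous (hφ : IsStationaryFront D f φ) : Continuous φ := hφ.differentiable.continuous

theorem hasDerivAt (hφ : IsStationaryFront D f φ) (x : ℝ) : HasDerivAt φ (deriv φ x) x :=
  (hφ.differentiable x).hasDerivAt

theorem deriv_nonpos (hφ : IsStationaryFront D f φ) (x : ℝ) : deriv φ x ≤ 0 :=
  hφ.antitone.deriv_nonpos

theorem hasDerivAt_flux (hφ : IsStationaryFront D f φ) (x : ℝ) :
    HasDerivAt (frontFlux D φ) (-f (φ x)) x := hφ.profile_eq x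

theorem continuous_flux (hφ : IsStationaryFront D f φ) : Continuous (frontFlux D φ) :=
  continuous_iff_continuousAt.2 fun x => (hφ.hasDerivAt_flux x).continuousAt

theorem flux_nonpos (hφ : IsStationaryFront D f φ) (hD : IsDegenerateDiffusivity D) (x : ℝ) :
    frontFlux D φ x ≤ 0 :=
  mul_nonpos_of_nonneg_of_nonpos (hD.nonneg (hφ.mem_Icc x)) (hφ.deriv_nonpos x)

theorem continuous_comp (hφ : IsStationaryFront D f φ) {g : ℝ → ℝ}
    (hg : ContinuousOn g (Icc 0 1)) : Continuous fun x => g (φ x) :=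
  hg.comp_continuous hφ.continuous hφ.mem_Icc

theorem tendsto_comp_atBot (hφ : IsStationaryFront D f φ) {g : ℝ → ℝ}
    (hg : ContinuousOn g (Icc 0 1)) : Tendsto (fun x => g (φ x)) atBot (𝓝 (g 1)) :=
  (hg 1 (right_mem_Icc.2 zero_le_one)).tendsto.comp
    (tendsto_nhdsWithin_iff.2 ⟨hφ.tendsto_atBot, Eventually.of_forall hφ.mem_Icc⟩)

theorem tendsto_comp_atTop (hφ : IsStationaryFront D f φ) {g : ℝ → ℝ}
    (hg : ContinuousOn g (Icc 0 1)) : Tendsto (fun x => g (φ x)) atTop (𝓝 (g 0)) :=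
  (hg 0 (left_mem_Icc.2 zero_le_one)).tendsto.comp
    (tendsto_nhdsWithin_iff.2 ⟨hφ.tendsto_atTop, Eventually.of_forall hφ.mem_Icc⟩)

theorem hasDerivAt_comp (hφ : IsStationaryFront D f φ) {g : ℝ → ℝ}
    (hg : ContDiffOn ℝ 2 g (Icc 0 1)) (x : ℝ) :
    HasDerivAt (fun y => g (φ y)) (derivWithin g (Icc 0 1) (φ x) * deriv φ x) x := by
  have h := (hg.hasDerivWithinAt_unit (hφ.mem_Icc x)).comp x
    (hφ.hasDerivAt x).hasDerivWithinAt (s := univ) (fun y _ => hφ.mem_Icc y)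
  exact hasDerivWithinAt_univ.1 h

/-- The first integral of the profile equation. -/
theorem flux_sq (hφ : IsStationaryFront D f φ) (hD : IsDegenerateDiffusivity D)
    (hf : IsBistable f α) (hDf : ∫ u in (0 : ℝ)..1, D u * f u = 0) (x : ℝ) :
    frontFlux D φ x ^ 2 = frontPotential D f (φ x) := by
  have hd : ∀ x, HasDerivAt (fun y => frontFlux D φ y ^ 2 - frontPotential D f (φ y)) 0 x := by
    intro x
    refine (((hφ.hasDerivAt_flux x).pow 2).sub ((hasDerivAt_frontPotential hD hf
      (hφ.mem_Icc x)).comp x (hφ.hasDerivAt x))).congr_deriv ?_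
    norm_num [frontFlux]
    ring
  have hconst := is_const_of_deriv_eq_zero (fun x => (hd x).differentiableAt)
    (fun x => (hd x).deriv)
  set k := frontFlux D φ 0 ^ 2 - frontPotential D f (φ 0) with hk
  have hp : ∀ x, frontFlux D φ x ^ 2 = frontPotential D f (φ x) + k := fun x => by
    have := hconst x 0
    linarith
  -- Let `x → +∞` in `G(φ) + k = P² ≥ 0`; there `G(φ)` tends to `0`.
  have hk0 : 0 ≤ k := by
    have ht := (hφ.tendsto_comp_atTop (continuousOn_frontPotential hD hf)).add_const k
    rw [frontPotential_zero, zero_add] at ht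
    exact ge_of_tendsto' ht fun x => by rw [← hp]; positivity
  rcases hk0.eq_or_lt with h | h
  · rw [hp, ← h, add_zero]
  exfalso
  obtain ⟨M, hM, hDM⟩ := hD.exists_le_mul
  have hsq : 0 < √k := Real.sqrt_pos.2 h
  -- If `k > 0`, then `|P| ≥ √k` everywhere, so `φ` decreases at least at the fixed rate `√k / M`
  -- and would drop by `2` over the length `2M/√k`, leaving `[0,1]`.
  have hle : ∀ x, deriv φ x ≤ -(√k / M) := by
    intro x
    have h1 : k ≤ frontFlux D φ x ^ 2 := by
      rw [hp]
      linarith [frontPotential_nonneg hD hf hDf (hφ.mem_Icc x)]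
    have h2 : √k ≤ -frontFlux D φ x :=
      Real.sqrt_le_left (by linarith [hφ.flux_nonpos hD x]) |>.2 (by rwa [neg_sq])
    have h3 : D (φ x) ≤ M := (hDM _ (hφ.mem_Icc x)).trans (by nlinarith [(hφ.mem_Icc x).2])
    have h4 := hφ.deriv_nonpos x
    have h5 : √k ≤ M * (-deriv φ x) := by
      refine h2.trans ?_
      rw [frontFlux, ← mul_neg]
      exact mul_le_mul_of_nonneg_right h3 (by linarith)
    rw [le_neg, div_le_iff₀ hM]
    linarith
  have hanti : Antitone fun x => φ x + √k / M * x :=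
    antitone_of_hasDerivAt_nonpos (f' := fun x => deriv φ x + √k / M * 1)
      (fun x => (hφ.hasDerivAt x).add ((hasDerivAt_id x).const_mul _))
      (fun x => by have := hle x; simp only [Pi.zero_apply]; linarith)
  have hlt : 0 < √k / M := by positivity
  have h1 := hanti (show (0 : ℝ) ≤ 2 / (√k / M) by positivity)
  simp only [mul_zero, add_zero, mul_div_cancel₀ _ hlt.ne'] at h1
  linarith [(hφ.mem_Icc 0).2, (hφ.mem_Icc (2 / (√k / M))).1]

theorem deriv_eq_zero (hφ : IsStationaryFront D f φ) {x : ℝ} (hx : φ x = 0) : deriv φ x = 0 :=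
  IsLocalMin.deriv_eq_zero (Eventually.of_forall fun y => by rw [hx]; exact (hφ.mem_Icc y).1)

theorem exists_abs_deriv_le (hφ : IsStationaryFront D f φ) (hD : IsDegenerateDiffusivity D)
    (hf : IsBistable f α) (hDf : ∫ u in (0 : ℝ)..1, D u * f u = 0) :
    ∃ C : ℝ, 0 < C ∧ ∀ x, |deriv φ x| ≤ C := by
  obtain ⟨C, hC, h⟩ := exists_frontPotential_le_sq hD hf
  refine ⟨√C, Real.sqrt_pos.2 hC, fun x => ?_⟩
  rcases (hφ.mem_Icc x).1.eq_or_lt with h0 | h0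
  · rw [hφ.deriv_eq_zero h0.symm, abs_zero]
    positivity
  · have hDp := hD.pos _ ⟨h0, (hφ.mem_Icc x).2⟩
    have h1 := h _ (hφ.mem_Icc x)
    rw [← hφ.flux_sq hD hf hDf, frontFlux, mul_pow, mul_comm] at h1
    exact Real.abs_le_sqrt (le_of_mul_le_mul_right h1 (by positivity))

theorem exists_eq (hφ : IsStationaryFront D f φ) {s : ℝ} (hs : s ∈ Ioo (0 : ℝ) 1) :
    ∃ x, φ x = s := by
  obtain ⟨a, ha⟩ := (hφ.tendsto_atBot.eventually (lt_mem_nhds hs.2)).exists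
  obtain ⟨b, hb⟩ := (hφ.tendsto_atTop.eventually (gt_mem_nhds hs.1)).exists
  exact mem_range_of_exists_le_of_exists_ge hφ.continuous ⟨b, hb.le⟩ ⟨a, ha.le⟩

/-- A Grönwall argument: where `φ ≥ 1/2`, `D(φ)` is bounded below, so the quadratic bound on `G` at
`1` gives `-φ_x ≤ K (1 - φ)` and `(1 - φ) exp(-K x)` is nonincreasing. Once at `1`, the front could
not descend to `1/2`. -/
theorem lt_one (hφ : IsStationaryFront D f φ) (hD : IsDegenerateDiffusivity D)
    (hf : IsBistable f α) (hDf : ∫ u in (0 : ℝ)..1, D u * f u = 0) (x : ℝ) : φ x < 1 := by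
  refine (hφ.mem_Icc x).2.lt_of_ne fun hx1 => ?_
  obtain ⟨b, hb⟩ := hφ.exists_eq (s := 1 / 2) ⟨by norm_num, by norm_num⟩
  have hxb : x ≤ b := by
    by_contra hn
    have := hφ.antitone (not_le.1 hn).le
    rw [hb, hx1] at this
    norm_num at this
  obtain ⟨d, hd, hDd⟩ := hD.exists_mul_le
  obtain ⟨C, hC, hGC⟩ := exists_frontPotential_le_one_sub_sq hD hf hDf
  set K := √C / (d / 2) with hK
  have hbound : ∀ y ∈ Ioo x b, -deriv φ y ≤ K * (1 - φ y) := by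
    intro y hy
    have h2 : 1 / 2 ≤ φ y := hb ▸ hφ.antitone hy.2.le
    have hm := hφ.mem_Icc y
    have h3 : d / 2 ≤ D (φ y) := le_trans (by nlinarith) (hDd _ hm)
    have h4 := hGC _ hm
    rw [← hφ.flux_sq hD hf hDf] at h4
    have h5 : |frontFlux D φ y| ≤ √C * (1 - φ y) := by
      refine abs_le_of_sq_le_sq ?_ (mul_nonneg (Real.sqrt_nonneg _) (by linarith [hm.2]))
      rwa [mul_pow, Real.sq_sqrt hC.le]
    have h6 : d / 2 * (-deriv φ y) ≤ √C * (1 - φ y) := by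
      refine le_trans ?_ h5
      refine le_trans ?_ (neg_le_abs _)
      rw [frontFlux, ← mul_neg]
      exact mul_le_mul_of_nonneg_right h3 (by linarith [hφ.deriv_nonpos y])
    rw [hK, div_mul_eq_mul_div, le_div_iff₀ (by positivity)]
    linarith
  have hmono : MonotoneOn (fun y => -((1 - φ y) * Real.exp (-K * y))) (Icc x b) :=
    monotoneOn_Icc_of_hasDerivAt
      (g' := fun y => -((-deriv φ y) * Real.exp (-K * y) +
        (1 - φ y) * (Real.exp (-K * y) * (-K * 1))))
      (by have := hφ.continuous; fun_prop)
      (fun y _ => (((hφ.hasDerivAt y).const_sub 1).mul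
        (((hasDerivAt_id y).const_mul (-K)).exp)).neg)
      (fun y hy => by
        have h1 := hbound y hy
        have h2 := Real.exp_pos (-K * y)
        have : 0 ≤ (K * (1 - φ y) + deriv φ y) * Real.exp (-K * y) :=
          mul_nonneg (by linarith) h2.le
        linarith)
  have := hmono (left_mem_Icc.2 hxb) (right_mem_Icc.2 hxb) hxb
  simp only [hx1, hb, sub_self, zero_mul, neg_zero] at this
  have := Real.exp_pos (-K * b)
  linarith

/-- `|P| = √G(φ)` is at least a multiple of `φ^(3/2)`, while `|P| ≤ L φ |φ_x|`. The restriction `φ ≤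
1/2` gives `(1 - φ)² ≥ 1/4`, the source of `k / 4`. -/
theorem exists_deriv_le_neg_sqrt (hφ : IsStationaryFront D f φ) (hD : IsDegenerateDiffusivity D)
    (hf : IsBistable f α) (hDf : ∫ u in (0 : ℝ)..1, D u * f u = 0) :
    ∃ c : ℝ, 0 < c ∧ ∀ x, 0 < φ x → φ x ≤ 1 / 2 → deriv φ x ≤ -(c * √(φ x)) := by
  obtain ⟨k, hk, hG⟩ := exists_le_frontPotential hD hf hDf
  obtain ⟨L, hL, hDL⟩ := hD.exists_le_mul
  refine ⟨√(k / 4) / L, by positivity, fun x h0 h1 => ?_⟩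
  have hm := hφ.mem_Icc x
  have h2 := hG _ hm
  rw [← hφ.flux_sq hD hf hDf] at h2
  have h3 : k / 4 * φ x ^ 3 ≤ frontFlux D φ x ^ 2 := by
    refine le_trans ?_ h2
    have : (1 / 4 : ℝ) ≤ (1 - φ x) ^ 2 := by nlinarith
    have : k * φ x ^ 3 * (1 / 4) ≤ k * φ x ^ 3 * (1 - φ x) ^ 2 :=
      mul_le_mul_of_nonneg_left this (by positivity)
    linarith
  have h4 : -frontFlux D φ x ≤ L * φ x * -deriv φ x := by
    rw [frontFlux, ← mul_neg]
    exact mul_le_mul_of_nonneg_right (hDL _ hm) (by linarith [hφ.deriv_nonpos x])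
  have h5 : √(k / 4) * √(φ x) * φ x ≤ -frontFlux D φ x := by
    refine le_of_sq_le_sq ?_ (by linarith [hφ.flux_nonpos hD x])
    rw [mul_pow, mul_pow, Real.sq_sqrt (by positivity), Real.sq_sqrt h0.le, neg_sq]
    linarith
  have h6 : √(k / 4) * √(φ x) ≤ L * -deriv φ x := by
    refine le_of_mul_le_mul_right ?_ h0
    linarith
  rw [le_neg, div_mul_eq_mul_div, div_le_iff₀ hL]
  linarith

/-- The front reaches the degenerate state at a finite point. -/
theorem exists_edge (hφ : IsStationaryFront D f φ) (hD : IsDegenerateDiffusivity D)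
    (hf : IsBistable f α) (hDf : ∫ u in (0 : ℝ)..1, D u * f u = 0) :
    ∃ x₀, (∀ x < x₀, 0 < φ x) ∧ ∀ x, x₀ ≤ x → φ x = 0 := by
  obtain ⟨c, hc, hle⟩ := hφ.exists_deriv_le_neg_sqrt hD hf hDf
  obtain ⟨b, hb⟩ := hφ.exists_eq (s := 1 / 2) ⟨by norm_num, by norm_num⟩
  have hne : ∃ x, φ x = 0 := by
    by_contra! hn
    have hpos : ∀ x, 0 < φ x := fun x => (hφ.mem_Icc x).1.lt_of_ne' (hn x)
    -- As long as `φ > 0`, `√φ` falls at rate at least `c / 2`. The length is chosen so that it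
    -- would fall by `2` from a value at most `1`.
    set y := b + 2 * (c / 2)⁻¹ with hy
    have hby : b ≤ y := by rw [hy]; have : 0 < 2 * (c / 2)⁻¹ := by positivity
                           linarith
    have hmono : MonotoneOn (fun t => -(√(φ t) + c / 2 * t)) (Icc b y) :=
      monotoneOn_Icc_of_hasDerivAt (g' := fun t => -(deriv φ t / (2 * √(φ t)) + c / 2 * 1))
        (by have := hφ.continuous; fun_prop)
        (fun t _ => (((hφ.hasDerivAt t).sqrt (hpos t).ne').add
          ((hasDerivAt_id t).const_mul _)).neg)
        (fun t ht => by
          have h1 := hle t (hpos t) (hb ▸ hφ.antitone ht.1.le)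
          have h2 := Real.sqrt_pos.2 (hpos t)
          have : deriv φ t / (2 * √(φ t)) ≤ -(c / 2) := by
            rw [div_le_iff₀ (by positivity)]
            linarith
          linarith)
    have h1 := hmono (left_mem_Icc.2 hby) (right_mem_Icc.2 hby) hby
    simp only at h1
    have h2 : √(φ b) ≤ 1 := Real.sqrt_le_one.2 (by rw [hb]; norm_num)
    have h3 : c / 2 * y = c / 2 * b + 2 := by rw [hy]; field_simp
    linarith [Real.sqrt_nonneg (φ y)]
  set Z := {x | φ x = 0} with hZ
  have hbdd : BddBelow Z := by
    refine ⟨b, fun x hx => ?_⟩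
    by_contra hn
    have := hφ.antitone (not_le.1 hn).le
    rw [hb, show φ x = 0 from hx] at this
    norm_num at this
  have hcl : IsClosed Z := isClosed_eq hφ.continuous continuous_const
  have hmem : φ (sInf Z) = 0 := hcl.csInf_mem hne hbdd
  refine ⟨sInf Z, fun x hx => (hφ.mem_Icc x).1.lt_of_ne' fun h => ?_, fun x hx => ?_⟩
  · exact absurd (csInf_le hbdd h) (not_le.2 hx)
  · exact le_antisymm (hmem ▸ hφ.antitone hx) (hφ.mem_Icc x).1

/-- The inequality `(√φ)' ≤ -c/2` integrated backwards from the edge gives linear growth of `√φ`. To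
the left of the point where `φ = 1/2`, monotonicity suffices, whence the cut-off at `1`. -/
theorem exists_mul_min_le_sqrt (hφ : IsStationaryFront D f φ) (hD : IsDegenerateDiffusivity D)
    (hf : IsBistable f α) (hDf : ∫ u in (0 : ℝ)..1, D u * f u = 0) {x₀ : ℝ}
    (h₁ : ∀ x < x₀, 0 < φ x) (h₂ : ∀ x, x₀ ≤ x → φ x = 0) :
    ∃ c : ℝ, 0 < c ∧ ∀ x < x₀, c * min 1 (x₀ - x) ≤ √(φ x) := by
  obtain ⟨c, hc, hle⟩ := hφ.exists_deriv_le_neg_sqrt hD hf hDf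
  obtain ⟨b, hb⟩ := hφ.exists_eq (s := 1 / 2) ⟨by norm_num, by norm_num⟩
  refine ⟨min (c / 2) (1 / 2), by positivity, fun x hx => ?_⟩
  have hx0 : 0 < x₀ - x := by linarith
  rcases le_total x b with h | h
  · have : 1 / 2 ≤ √(φ x) := by
      refine Real.le_sqrt_of_sq_le ?_
      have := hφ.antitone h
      rw [hb] at this
      linarith
    calc min (c / 2) (1 / 2) * min 1 (x₀ - x) ≤ 1 / 2 * 1 :=
          mul_le_mul (min_le_right _ _) (min_le_left _ _) (by positivity) (by norm_num)
      _ ≤ _ := by linarith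
  · have hmono : MonotoneOn (fun t => -(√(φ t) + c / 2 * t)) (Icc x x₀) :=
      monotoneOn_Icc_of_hasDerivAt (g' := fun t => -(deriv φ t / (2 * √(φ t)) + c / 2 * 1))
        (by have := hφ.continuous; fun_prop)
        (fun t ht => (((hφ.hasDerivAt t).sqrt (h₁ t ht.2).ne').add
          ((hasDerivAt_id t).const_mul _)).neg)
        (fun t ht => by
          have h1 := hle t (h₁ t ht.2) (hb ▸ hφ.antitone (h.trans ht.1.le))
          have h2 := Real.sqrt_pos.2 (h₁ t ht.2)
          have : deriv φ t / (2 * √(φ t)) ≤ -(c / 2) := by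
            rw [div_le_iff₀ (by positivity)]
            linarith
          linarith)
    have h1 := hmono (left_mem_Icc.2 hx.le) (right_mem_Icc.2 hx.le) hx.le
    simp only [h₂ x₀ le_rfl, Real.sqrt_zero, zero_add] at h1
    calc min (c / 2) (1 / 2) * min 1 (x₀ - x) ≤ c / 2 * (x₀ - x) :=
          mul_le_mul (min_le_left _ _) (min_le_right _ _) (by positivity) (by positivity)
      _ ≤ _ := by linarith

/-- `f(s)²` is at most a multiple of `s²(1-s)²` and `G(s)` at least a multiple of `s³(1-s)²`. So
`f(φ)` is controlled by the flux up to a loss of `√φ` at the edge. -/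
theorem exists_sqrt_mul_abs_reaction_le (hφ : IsStationaryFront D f φ)
    (hD : IsDegenerateDiffusivity D) (hf : IsBistable f α)
    (hDf : ∫ u in (0 : ℝ)..1, D u * f u = 0) :
    ∃ C : ℝ, 0 < C ∧ ∀ x, √(φ x) * |f (φ x)| ≤ C * |frontFlux D φ x| := by
  obtain ⟨k, hk, hG⟩ := exists_le_frontPotential hD hf hDf
  obtain ⟨L, hL, hfL⟩ := hf.exists_abs_le
  refine ⟨L / √k, by positivity, fun x => ?_⟩
  have hm := hφ.mem_Icc x
  have h1 := hG _ hm
  rw [← hφ.flux_sq hD hf hDf] at h1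
  have h2 := (hfL _ hm).2.2
  have h3 : |f (φ x)| ^ 2 ≤ (L * (φ x * (1 - φ x))) ^ 2 := pow_le_pow_left₀ (abs_nonneg _) h2 2
  refine le_of_sq_le_sq ?_ (by positivity)
  rw [mul_pow, mul_pow, div_pow, Real.sq_sqrt hm.1, Real.sq_sqrt hk.le, sq_abs (frontFlux D φ x),
    div_mul_eq_mul_div, le_div_iff₀ hk]
  have h4 : φ x * |f (φ x)| ^ 2 * k ≤ φ x * (L * (φ x * (1 - φ x))) ^ 2 * k :=
    mul_le_mul_of_nonneg_right (mul_le_mul_of_nonneg_left h3 hm.1) hk.le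
  have h5 := mul_le_mul_of_nonneg_left h1 (sq_nonneg L)
  refine h4.trans (le_trans (le_of_eq ?_) h5)
  ring

/-- The loss `√φ` is regained from `P = D(φ) φ_x`, because `D(φ) ≤ L φ ≤ L √φ`. This puts `f(φ)` in
`L²` along with `φ_x`. -/
theorem exists_abs_reaction_le_deriv (hφ : IsStationaryFront D f φ)
    (hD : IsDegenerateDiffusivity D) (hf : IsBistable f α)
    (hDf : ∫ u in (0 : ℝ)..1, D u * f u = 0) :
    ∃ C : ℝ, 0 < C ∧ ∀ x, |f (φ x)| ≤ C * |deriv φ x| := by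
  obtain ⟨C, hC, h⟩ := hφ.exists_sqrt_mul_abs_reaction_le hD hf hDf
  obtain ⟨L, hL, hDL⟩ := hD.exists_le_mul
  refine ⟨C * L, by positivity, fun x => ?_⟩
  have hm := hφ.mem_Icc x
  rcases hm.1.eq_or_lt with h0 | h0
  · rw [← h0, hf.map_zero, abs_zero]
    positivity
  have hs := Real.sqrt_pos.2 h0
  have h1 := h x
  rw [frontFlux, abs_mul, abs_of_nonneg (hD.nonneg hm)] at h1
  have h2 : √(φ x) * |f (φ x)| ≤ √(φ x) * (C * L * |deriv φ x|) := by
    refine h1.trans ?_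
    have h3 : D (φ x) ≤ L * √(φ x) := by
      refine (hDL _ hm).trans (mul_le_mul_of_nonneg_left ?_ hL.le)
      nlinarith [Real.sq_sqrt h0.le, Real.sqrt_le_one.2 hm.2]
    have h4 := mul_le_mul_of_nonneg_right h3 (abs_nonneg (deriv φ x))
    have h5 := mul_le_mul_of_nonneg_left h4 hC.le
    linarith
  exact le_of_mul_le_mul_left h2 hs

/-- The loss `√φ` is traded for the distance to the edge, the form that matches `‖W x‖ ≤ K (x₀ - x)`
for solutions vanishing at `x₀`. -/
theorem exists_abs_reaction_le_flux (hφ : IsStationaryFront D f φ)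
    (hD : IsDegenerateDiffusivity D) (hf : IsBistable f α)
    (hDf : ∫ u in (0 : ℝ)..1, D u * f u = 0) {x₀ : ℝ}
    (h₁ : ∀ x < x₀, 0 < φ x) (h₂ : ∀ x, x₀ ≤ x → φ x = 0) :
    ∃ C : ℝ, 0 < C ∧ ∀ x < x₀, min 1 (x₀ - x) * |f (φ x)| ≤ C * |frontFlux D φ x| := by
  obtain ⟨C, hC, h⟩ := hφ.exists_sqrt_mul_abs_reaction_le hD hf hDf
  obtain ⟨c, hc, h'⟩ := hφ.exists_mul_min_le_sqrt hD hf hDf h₁ h₂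
  refine ⟨C / c, by positivity, fun x hx => ?_⟩
  rw [div_mul_eq_mul_div, le_div_iff₀ hc]
  have := mul_le_mul_of_nonneg_right (h' x hx) (abs_nonneg (f (φ x)))
  linarith [h x]

theorem flux_neg (hφ : IsStationaryFront D f φ) (hD : IsDegenerateDiffusivity D)
    (hf : IsBistable f α) (hDf : ∫ u in (0 : ℝ)..1, D u * f u = 0) {x : ℝ} (hx : 0 < φ x) :
    frontFlux D φ x < 0 := by
  refine (hφ.flux_nonpos hD x).lt_of_ne fun h => ?_
  have h1 := frontPotential_pos hD hf hDf ⟨hx, hφ.lt_one hD hf hDf x⟩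
  rw [← hφ.flux_sq hD hf hDf, h] at h1
  norm_num at h1

theorem tendsto_flux_atBot (hφ : IsStationaryFront D f φ) (hD : IsDegenerateDiffusivity D)
    (hf : IsBistable f α) (hDf : ∫ u in (0 : ℝ)..1, D u * f u = 0) :
    Tendsto (frontFlux D φ) atBot (𝓝 0) := by
  have h := (hφ.tendsto_comp_atBot (continuousOn_frontPotential hD hf)).sqrt
  rw [frontPotential_one hDf, Real.sqrt_zero] at h
  refine squeeze_zero_norm (fun x => ?_) h
  rw [← hφ.flux_sq hD hf hDf, Real.sqrt_sq_eq_abs, Real.norm_eq_abs]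

theorem exists_abs_flux_le (hφ : IsStationaryFront D f φ) (hD : IsDegenerateDiffusivity D)
    (hf : IsBistable f α) (hDf : ∫ u in (0 : ℝ)..1, D u * f u = 0) :
    ∃ C : ℝ, 0 < C ∧ ∀ x, |frontFlux D φ x| ≤ C := by
  obtain ⟨C, hC, h⟩ := exists_frontPotential_le_one_sub_sq hD hf hDf
  refine ⟨√C, Real.sqrt_pos.2 hC, fun x => Real.abs_le_sqrt ?_⟩
  have hm := hφ.mem_Icc x
  rw [hφ.flux_sq hD hf hDf]
  refine (h _ hm).trans (mul_le_of_le_one_right hC.le ?_)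
  exact pow_le_one₀ (by linarith [hm.2]) (by linarith [hm.1])

/-! ### The derivative of the front as an eigenfunction -/

theorem integrable_deriv (hφ : IsStationaryFront D f φ) : Integrable (deriv φ) := by
  have h1 : IntegrableOn (deriv φ) (Ioi 0) :=
    integrableOn_Ioi_deriv_of_nonpos' (fun x _ => hφ.hasDerivAt x)
      (fun x _ => hφ.deriv_nonpos x) hφ.tendsto_atTop
  have h2 : IntegrableOn (fun x => -deriv φ (-x)) (Ioi 0) := by
    refine integrableOn_Ioi_deriv_of_nonneg' (g := fun x => φ (-x)) (l := 1) (fun x _ => ?_)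
      (fun x _ => by linarith [hφ.deriv_nonpos (-x)]) (hφ.tendsto_atBot.comp tendsto_neg_atTop_atBot)
    exact ((hφ.hasDerivAt (-x)).comp x (hasDerivAt_neg x)).congr_deriv (by ring)
  have h3 : IntegrableOn (deriv φ) (Iic 0) := by
    rw [integrableOn_Iic_iff_integrableOn_Iio]
    have h4 : IntegrableOn (fun x => - -deriv φ (-x)) (Ioi (-0)) := by
      rw [neg_zero]
      exact h2.neg
    simpa only [neg_neg] using h4.comp_neg_Iio
  rw [← integrableOn_univ, ← Iic_union_Ioi (a := (0 : ℝ))]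
  exact h3.union h1

theorem memLp_deriv (hφ : IsStationaryFront D f φ) (hD : IsDegenerateDiffusivity D)
    (hf : IsBistable f α) (hDf : ∫ u in (0 : ℝ)..1, D u * f u = 0) :
    MemLp (fun x => ((deriv φ x : ℝ) : ℂ)) 2 volume := by
  obtain ⟨C, hC, h⟩ := hφ.exists_abs_deriv_le hD hf hDf
  have hm : AEStronglyMeasurable (fun x => ((deriv φ x : ℝ) : ℂ)) volume :=
    (Complex.measurable_ofReal.comp (measurable_deriv φ)).aestronglyMeasurable
  rw [memLp_two_iff_integrable_sq_norm hm]
  refine (hφ.integrable_deriv.norm.const_mul C).mono' (hm.norm.pow 2) (ae_of_all _ fun x => ?_)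
  simp only [Complex.norm_real, Real.norm_eq_abs, abs_pow, abs_abs]
  rw [sq]
  exact mul_le_mul_of_nonneg_right (h x) (abs_nonneg _)

/-- This is the profile equation differentiated once more: `P' = -f(φ)` and `P'' = -f'(φ) φ_x` hold
classically on the whole line, and all three functions are dominated by multiples of `φ_x ∈ L²`. -/
theorem isH2WithSecondDeriv_flux (hφ : IsStationaryFront D f φ) (hD : IsDegenerateDiffusivity D)
    (hf : IsBistable f α) (hDf : ∫ u in (0 : ℝ)..1, D u * f u = 0) :
    IsH2WithSecondDeriv (fun x => ((frontFlux D φ x : ℝ) : ℂ))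
      (fun x => -(((derivWithin f (Icc 0 1) (φ x) * deriv φ x : ℝ)) : ℂ)) := by
  have hL := hφ.memLp_deriv hD hf hDf
  have hfd := hf.contDiffOn.continuousOn_derivWithin_unit
  obtain ⟨B, hB⟩ := isCompact_Icc.exists_bound_of_continuousOn hfd
  obtain ⟨C, hC, hfC⟩ := hφ.exists_abs_reaction_le_deriv hD hf hDf
  obtain ⟨M, hM, hDM⟩ := hD.exists_le_mul
  have hfc : Continuous fun x => ((-f (φ x) : ℝ) : ℂ) :=
    Complex.continuous_ofReal.comp (hφ.continuous_comp hf.contDiffOn.continuousOn).neg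
  have m1 : MemLp (fun x => ((frontFlux D φ x : ℝ) : ℂ)) 2 volume := by
    refine hL.of_le_mul (c := M)
      (Complex.continuous_ofReal.comp hφ.continuous_flux).aestronglyMeasurable
      (ae_of_all _ fun x => ?_)
    have hm := hφ.mem_Icc x
    simp only [Complex.norm_real, frontFlux, Real.norm_eq_abs, abs_mul,
      abs_of_nonneg (hD.nonneg hm)]
    exact mul_le_mul_of_nonneg_right ((hDM _ hm).trans (by nlinarith [hm.2])) (abs_nonneg _)
  have m2 : MemLp (fun x => ((-f (φ x) : ℝ) : ℂ)) 2 volume := by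
    refine hL.of_le_mul (c := C) hfc.aestronglyMeasurable (ae_of_all _ fun x => ?_)
    simp only [Complex.norm_real, Real.norm_eq_abs, abs_neg]
    exact hfC x
  have m3 : MemLp (fun x => -(((derivWithin f (Icc 0 1) (φ x) * deriv φ x : ℝ)) : ℂ)) 2 volume := by
    refine hL.of_le_mul (c := B) ?_ (ae_of_all _ fun x => ?_)
    · exact (Complex.measurable_ofReal.comp ((hφ.continuous_comp hfd).measurable.mul
        (measurable_deriv φ))).neg.aestronglyMeasurable
    · simp only [norm_neg, Complex.norm_real, norm_mul]
      exact mul_le_mul_of_nonneg_right (hB _ (hφ.mem_Icc x)) (norm_nonneg _)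
  refine ⟨m1, m3, _, m2, IsWeakDeriv.of_hasDerivAt (fun x => (hφ.hasDerivAt_flux x).ofReal_comp)
    (m2.locallyIntegrable (by norm_num)), IsWeakDeriv.of_hasDerivAt (fun x => ?_)
    (m3.locallyIntegrable (by norm_num))⟩
  have := (hφ.hasDerivAt_comp hf.contDiffOn x).neg.ofReal_comp
  rwa [Complex.ofReal_neg] at this

end IsStationaryFront

/-! ### Monotonicity arguments on a half-line -/

/-- A mean value inequality with a real majorant, replacing integrals of `q'`. It is applied with `g
= 0` for constancy, with multiples of `-φ` (total variation one), and with a multiple of `(φ -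
α)/P`. -/
theorem norm_sub_le_sub_of_norm_deriv_le {x₀ : ℝ} {q q' : ℝ → ℂ} {g g' : ℝ → ℝ}
    (hq : ∀ x < x₀, HasDerivAt q (q' x) x) (hg : ∀ x < x₀, HasDerivAt g (g' x) x)
    (hle : ∀ x < x₀, ‖q' x‖ ≤ g' x) {x y : ℝ} (hxy : x ≤ y) (hy : y < x₀) :
    ‖q y - q x‖ ≤ g y - g x := by
  have hlt : ∀ t ∈ Icc x y, t < x₀ := fun t ht => ht.2.trans_lt hy
  refine image_norm_le_of_norm_deriv_right_le_deriv_boundary' (f := fun t => q t - q x)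
    (f' := q') (B := fun t => g t - g x) (B' := g') (a := x) (b := y)
    (fun t ht => ((hq t (hlt t ht)).continuousAt.continuousWithinAt).sub continuousWithinAt_const)
    (fun t ht => ((hq t (hlt t ⟨ht.1, ht.2.le⟩)).sub_const _).hasDerivWithinAt) (by simp)
    (fun t ht => ((hg t (hlt t ht)).continuousAt.continuousWithinAt).sub continuousWithinAt_const)
    (fun t ht => ((hg t (hlt t ⟨ht.1, ht.2.le⟩)).sub_const _).hasDerivWithinAt)
    (fun t ht => hle t (hlt t ⟨ht.1, ht.2.le⟩)) (right_mem_Icc.2 hxy)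

theorem eventually_nhdsLT_lt_lt {x x₀ : ℝ} (hx : x < x₀) : ∀ᶠ y in 𝓝[<] x₀, x < y ∧ y < x₀ :=
  Ioo_mem_nhdsLT hx

/-- A monotone function on `(-∞, x₀)` which vanishes at both ends is zero. -/
theorem eq_zero_of_deriv_nonneg_of_tendsto {x₀ : ℝ} {g g' : ℝ → ℝ}
    (hg : ∀ x < x₀, HasDerivAt g (g' x) x) (hn : ∀ x < x₀, 0 ≤ g' x)
    (hb : Tendsto g atBot (𝓝 0)) (ht : Tendsto g (𝓝[<] x₀) (𝓝 0)) {x : ℝ} (hx : x < x₀) :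
    g x = 0 ∧ g' x = 0 := by
  have hm : MonotoneOn g (Iio x₀) :=
    monotoneOn_of_hasDerivWithinAt_nonneg (f' := g') (convex_Iio x₀)
      (fun t ht => (hg t ht).continuousAt.continuousWithinAt)
      (fun t ht => (hg t (by rwa [interior_Iio] at ht)).hasDerivWithinAt)
      (fun t ht => hn t (by rwa [interior_Iio] at ht))
  have h0 : ∀ y < x₀, g y = 0 := fun y hy => le_antisymm
    (ge_of_tendsto ht ((eventually_nhdsLT_lt_lt hy).mono fun t h => hm hy h.2 h.1.le))
    (le_of_tendsto hb ((eventually_le_atBot y).mono fun t h => hm (h.trans_lt hy) hy h))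
  refine ⟨h0 x hx, ?_⟩
  have : g =ᶠ[𝓝 x] fun _ => 0 := eventually_of_mem (Iio_mem_nhds hx) h0
  exact (hg x hx).unique ((hasDerivAt_const x (0 : ℝ)).congr_of_eventuallyEq this)

/-! ### The resolvent equation on the support of the front -/

/-- `W` solves `W'' + f'(φ) W / D(φ) = z W / D(φ) + c φ_x` to the left of the edge `x₀` of the
front, vanishes at both ends, and has a bounded derivative. -/
structure IsEdgeSolution (D f φ : ℝ → ℝ) (x₀ : ℝ) (z c : ℂ) (W W₁ : ℝ → ℂ) : Prop where
  hasDerivAt : ∀ x, HasDerivAt W (W₁ x) x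
  hasDerivAt_deriv : ∀ x < x₀, HasDerivAt W₁
    ((z - (derivWithin f (Icc 0 1) (φ x) : ℝ)) * (W x / (D (φ x) : ℝ)) + c * (deriv φ x : ℝ)) x
  edge : W x₀ = 0
  tendsto_atBot : Tendsto W atBot (𝓝 0)
  bounded : ∃ K, ∀ x ≤ x₀, ‖W x‖ ≤ K ∧ ‖W₁ x‖ ≤ K

/-- The Wronskian of `W` and the flux of the front. -/
noncomputable def fluxWronskian (D f φ : ℝ → ℝ) (W W₁ : ℝ → ℂ) (x : ℝ) : ℂ :=
  (frontFlux D φ x : ℂ) * W₁ x + (f (φ x) : ℂ) * W x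

/-! ### Wronskian identities, the kernel and Jordan chains -/

namespace IsEdgeSolution

variable {D f φ : ℝ → ℝ} {α x₀ : ℝ} {z c : ℂ} {W W₁ : ℝ → ℂ}

/-- `P` solves the equation with `z = c = 0`, so the terms with `f'(φ)` cancel. The singular factor
disappears because `P / D(φ) = φ_x`. -/
theorem hasDerivAt_wronskian (h : IsEdgeSolution D f φ x₀ z c W W₁)
    (hD : IsDegenerateDiffusivity D) (hf : IsBistable f α) (hφ : IsStationaryFront D f φ)
    (h₁ : ∀ x < x₀, 0 < φ x) {x : ℝ} (hx : x < x₀) :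
    HasDerivAt (fluxWronskian D f φ W W₁)
      (((deriv φ x : ℝ) : ℂ) * (z * W x + c * (frontFlux D φ x : ℂ))) x := by
  have hDp : ((D (φ x) : ℝ) : ℂ) ≠ 0 :=
    Complex.ofReal_ne_zero.2 (hD.pos _ ⟨h₁ x hx, (hφ.mem_Icc x).2⟩).ne'
  refine (((hφ.hasDerivAt_flux x).ofReal_comp.mul (h.hasDerivAt_deriv x hx)).add
    ((hφ.hasDerivAt_comp hf.contDiffOn x).ofReal_comp.mul (h.hasDerivAt x))).congr_deriv ?_
  simp only [frontFlux]
  push_cast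
  field_simp
  ring

theorem norm_wronskian_le {K : ℝ} (hK : ∀ x ≤ x₀, ‖W x‖ ≤ K ∧ ‖W₁ x‖ ≤ K) {x : ℝ} (hx : x ≤ x₀) :
    ‖fluxWronskian D f φ W W₁ x‖ ≤ |frontFlux D φ x| * K + |f (φ x)| * K := by
  refine (norm_add_le _ _).trans ?_
  rw [norm_mul, norm_mul, Complex.norm_real, Complex.norm_real, Real.norm_eq_abs, Real.norm_eq_abs]
  exact add_le_add (mul_le_mul_of_nonneg_left (hK x hx).2 (abs_nonneg _))
    (mul_le_mul_of_nonneg_left (hK x hx).1 (abs_nonneg _))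

theorem tendsto_wronskian_atBot (h : IsEdgeSolution D f φ x₀ z c W W₁)
    (hD : IsDegenerateDiffusivity D) (hf : IsBistable f α)
    (hDf : ∫ u in (0 : ℝ)..1, D u * f u = 0) (hφ : IsStationaryFront D f φ) :
    Tendsto (fluxWronskian D f φ W W₁) atBot (𝓝 0) := by
  obtain ⟨K, hK⟩ := h.bounded
  have h1 := ((hφ.tendsto_flux_atBot hD hf hDf).abs.mul_const K).add
    ((hφ.tendsto_comp_atBot hf.contDiffOn.continuousOn).abs.mul_const K)
  rw [hf.map_one, abs_zero, zero_mul, add_zero] at h1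
  exact squeeze_zero_norm' ((eventually_le_atBot x₀).mono fun x hx => norm_wronskian_le hK hx) h1

theorem tendsto_wronskian_edge (h : IsEdgeSolution D f φ x₀ z c W W₁)
    (hf : IsBistable f α) (hφ : IsStationaryFront D f φ)
    (h₂ : ∀ x, x₀ ≤ x → φ x = 0) :
    Tendsto (fluxWronskian D f φ W W₁) (𝓝[<] x₀) (𝓝 0) := by
  obtain ⟨K, hK⟩ := h.bounded
  have h1 := ((hφ.continuous_flux.tendsto x₀).abs.mul_const K).add
    (((hφ.continuous_comp hf.contDiffOn.continuousOn).tendsto x₀).abs.mul_const K)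
  have e1 : frontFlux D φ x₀ = 0 := by rw [frontFlux, hφ.deriv_eq_zero (h₂ x₀ le_rfl), mul_zero]
  rw [e1, h₂ x₀ le_rfl, hf.map_zero, abs_zero, zero_mul, add_zero] at h1
  exact squeeze_zero_norm' (eventually_mem_nhdsWithin.mono fun x hx =>
    norm_wronskian_le hK (le_of_lt hx)) (h1.mono_left nhdsWithin_le_nhds)

/-- There is no Jordan chain over the derivative of the front. -/
theorem eq_zero_of_forcing (h : IsEdgeSolution D f φ x₀ 0 c W W₁)
    (hD : IsDegenerateDiffusivity D) (hf : IsBistable f α)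
    (hDf : ∫ u in (0 : ℝ)..1, D u * f u = 0) (hφ : IsStationaryFront D f φ)
    (h₁ : ∀ x < x₀, 0 < φ x) (h₂ : ∀ x, x₀ ≤ x → φ x = 0) : c = 0 := by
  by_contra hc
  -- Division by `c` leaves the real derivative `φ_x P = D(φ) φ_x² ≥ 0`. With limit `0` at both ends
  -- it must vanish, contradicting `P < 0` left of the edge.
  have hderiv : ∀ x < x₀, HasDerivAt (fun y => (fluxWronskian D f φ W W₁ y / c).re)
      (deriv φ x * frontFlux D φ x) x := by
    intro x hx
    have h3 := (h.hasDerivAt_wronskian hD hf hφ h₁ hx).div_const c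
    have h4 : ((deriv φ x : ℝ) : ℂ) * (0 * W x + c * (frontFlux D φ x : ℂ)) / c =
        ((deriv φ x * frontFlux D φ x : ℝ) : ℂ) := by
      push_cast
      field_simp
      ring
    rw [h4] at h3
    exact (Complex.reCLM.hasFDerivAt.comp_hasDerivAt x h3)
  have lim : ∀ l : Filter ℝ, Tendsto (fluxWronskian D f φ W W₁) l (𝓝 0) →
      Tendsto (fun y => (fluxWronskian D f φ W W₁ y / c).re) l (𝓝 0) := fun l hl => by
    have := (Complex.continuous_re.tendsto _).comp (hl.div_const c)
    rwa [zero_div, Complex.zero_re] at this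
  have hneg : ∀ x < x₀, frontFlux D φ x < 0 := fun x hx => hφ.flux_neg hD hf hDf (h₁ x hx)
  have key := (eq_zero_of_deriv_nonneg_of_tendsto hderiv
    (fun x hx => mul_nonneg_of_nonpos_of_nonpos (hφ.deriv_nonpos x) (hneg x hx).le)
    (lim _ (h.tendsto_wronskian_atBot hD hf hDf hφ)) (lim _ (h.tendsto_wronskian_edge hf hφ h₂))
    (sub_one_lt x₀)).2
  have := hneg _ (sub_one_lt x₀)
  rcases mul_eq_zero.1 key with h' | h'
  · rw [frontFlux, h', mul_zero] at this
    exact lt_irrefl _ this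
  · exact this.ne h'

theorem hasDerivAt_div_flux (h : IsEdgeSolution D f φ x₀ z c W W₁)
    (hφ : IsStationaryFront D f φ) {x : ℝ} (hp : frontFlux D φ x ≠ 0) :
    HasDerivAt (fun y => W y / (frontFlux D φ y : ℂ))
      (fluxWronskian D f φ W W₁ x / (frontFlux D φ x : ℂ) ^ 2) x := by
  refine ((h.hasDerivAt x).div (hφ.hasDerivAt_flux x).ofReal_comp
    (Complex.ofReal_ne_zero.2 hp)).congr_deriv ?_
  simp only [fluxWronskian]
  push_cast
  ring

/-- The Wronskian is constant and tends to `0` at `-∞`, hence vanishes; then `W / P` has zero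
derivative. -/
theorem exists_eq_mul_flux (h : IsEdgeSolution D f φ x₀ 0 0 W W₁)
    (hD : IsDegenerateDiffusivity D) (hf : IsBistable f α)
    (hDf : ∫ u in (0 : ℝ)..1, D u * f u = 0) (hφ : IsStationaryFront D f φ)
    (h₁ : ∀ x < x₀, 0 < φ x) :
    ∃ k : ℂ, ∀ x < x₀, W x = k * (frontFlux D φ x : ℂ) := by
  have hne : ∀ x < x₀, frontFlux D φ x ≠ 0 := fun x hx => (hφ.flux_neg hD hf hDf (h₁ x hx)).ne
  have hq : ∀ x < x₀, fluxWronskian D f φ W W₁ x = 0 := by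
    intro x hx
    have hlim := h.tendsto_wronskian_atBot hD hf hDf hφ
    refine tendsto_nhds_unique (f := fun _ : ℝ => fluxWronskian D f φ W W₁ x) (l := atBot)
      tendsto_const_nhds (hlim.congr' ?_)
    filter_upwards [eventually_le_atBot x] with y hy
    have := norm_sub_le_sub_of_norm_deriv_le (g := fun _ => (0 : ℝ)) (g' := fun _ => 0)
      (fun t ht => h.hasDerivAt_wronskian hD hf hφ h₁ ht) (fun t _ => hasDerivAt_const t (0 : ℝ))
      (fun t _ => by simp) hy hx
    rw [sub_self, norm_le_zero_iff, sub_eq_zero] at this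
    exact this.symm
  have hh : ∀ x < x₀, ∀ y < x₀, x ≤ y →
      W y / (frontFlux D φ y : ℂ) = W x / (frontFlux D φ x : ℂ) := by
    intro x _ y hy hxy
    have := norm_sub_le_sub_of_norm_deriv_le (g := fun _ => (0 : ℝ)) (g' := fun _ => 0)
      (fun t ht => h.hasDerivAt_div_flux hφ (hne t ht)) (fun t _ => hasDerivAt_const t (0 : ℝ))
      (fun t ht => by simp [hq t ht]) hxy hy
    rwa [sub_self, norm_le_zero_iff, sub_eq_zero] at this
  refine ⟨W (x₀ - 1) / (frontFlux D φ (x₀ - 1) : ℂ), fun x hx => ?_⟩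
  have : W x / (frontFlux D φ x : ℂ) = W (x₀ - 1) / (frontFlux D φ (x₀ - 1) : ℂ) := by
    rcases le_total x (x₀ - 1) with hle | hle
    · exact (hh x hx _ (sub_one_lt x₀) hle).symm
    · exact hh _ (sub_one_lt x₀) x hx hle
  rw [← this, div_mul_cancel₀ _ (Complex.ofReal_ne_zero.2 (hne x hx))]

/-! ### Reality and sign of the eigenvalues -/

theorem norm_le_mul_sub (h : IsEdgeSolution D f φ x₀ z c W W₁) {K : ℝ}
    (hK : ∀ x ≤ x₀, ‖W x‖ ≤ K ∧ ‖W₁ x‖ ≤ K) {x : ℝ} (hx : x ≤ x₀) : ‖W x‖ ≤ K * (x₀ - x) := by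
  have := (convex_Icc x x₀).norm_image_sub_le_of_norm_hasDerivWithin_le
    (fun t _ => (h.hasDerivAt t).hasDerivWithinAt) (fun t ht => (hK t ht.2).2)
    (left_mem_Icc.2 hx) (right_mem_Icc.2 hx)
  rwa [h.edge, zero_sub, norm_neg, Real.norm_eq_abs, abs_of_nonneg (sub_nonneg.2 hx)] at this

/-- The quantity whose derivative is the density of the Dirichlet form. -/
theorem hasDerivAt_form (h : IsEdgeSolution D f φ x₀ z 0 W W₁)
    (hD : IsDegenerateDiffusivity D) (hf : IsBistable f α) (hφ : IsStationaryFront D f φ)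
    (h₁ : ∀ x < x₀, 0 < φ x) {x : ℝ} (hx : x < x₀) (hp : frontFlux D φ x ≠ 0) :
    HasDerivAt (fun y => starRingEnd ℂ (W y / (frontFlux D φ y : ℂ)) *
        fluxWronskian D f φ W W₁ y)
      (((‖fluxWronskian D f φ W W₁ x‖ ^ 2 / frontFlux D φ x ^ 2 : ℝ) : ℂ) +
        z * ((‖W x‖ ^ 2 / D (φ x) : ℝ) : ℂ)) x := by
  have hp' : (frontFlux D φ x : ℂ) ≠ 0 := Complex.ofReal_ne_zero.2 hp
  have hDp : ((D (φ x) : ℝ) : ℂ) ≠ 0 :=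
    Complex.ofReal_ne_zero.2 (hD.pos _ ⟨h₁ x hx, (hφ.mem_Icc x).2⟩).ne'
  have hd : ((deriv φ x : ℝ) : ℂ) = (frontFlux D φ x : ℂ) / (D (φ x) : ℝ) := by
    rw [frontFlux]
    push_cast
    field_simp
  have h3 : HasDerivAt (fun y => starRingEnd ℂ (W y / (frontFlux D φ y : ℂ)))
      (starRingEnd ℂ (fluxWronskian D f φ W W₁ x / (frontFlux D φ x : ℂ) ^ 2)) x :=
    Complex.conjCLE.toContinuousLinearMap.hasFDerivAt.comp_hasDerivAt x
      (h.hasDerivAt_div_flux hφ hp)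
  refine (h3.mul (h.hasDerivAt_wronskian hD hf hφ h₁ hx)).congr_deriv ?_
  rw [hd, map_div₀, map_div₀, map_pow, Complex.conj_ofReal]
  push_cast
  rw [← Complex.conj_mul', ← Complex.conj_mul']
  field_simp
  ring

/-- The denominator `P` vanishes at the edge and at `-∞`. Since `‖W‖ ≤ K min(1, x₀ - x)`, the term
`f(φ) W` is at most a multiple of `|P|`; so is the whole Wronskian, and this factor cancels `P`. The
form then vanishes at both ends together with `W`. -/
theorem exists_norm_form_le (h : IsEdgeSolution D f φ x₀ z c W W₁)
    (hD : IsDegenerateDiffusivity D) (hf : IsBistable f α)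
    (hDf : ∫ u in (0 : ℝ)..1, D u * f u = 0) (hφ : IsStationaryFront D f φ)
    (h₁ : ∀ x < x₀, 0 < φ x) (h₂ : ∀ x, x₀ ≤ x → φ x = 0) :
    ∃ K, 0 ≤ K ∧ ∀ x < x₀, ‖starRingEnd ℂ (W x / (frontFlux D φ x : ℂ)) *
      fluxWronskian D f φ W W₁ x‖ ≤ K * ‖W x‖ ∧ ‖W x‖ ≤ K * (x₀ - x) := by
  obtain ⟨K, hK⟩ := h.bounded
  obtain ⟨C, hC, hfC⟩ := hφ.exists_abs_reaction_le_flux hD hf hDf h₁ h₂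
  have hK0 : 0 ≤ K := (norm_nonneg _).trans (hK x₀ le_rfl).1
  refine ⟨K + C * K, by positivity, fun x hx => ?_⟩
  have hle := h.norm_le_mul_sub hK hx.le
  have hx0 : 0 < x₀ - x := by linarith
  refine ⟨?_, hle.trans (mul_le_mul_of_nonneg_right (by linarith [mul_nonneg hC.le hK0]) hx0.le)⟩
  have hp := hφ.flux_neg hD hf hDf (h₁ x hx)
  have hp' : 0 < |frontFlux D φ x| := abs_pos.2 hp.ne
  have hW : ‖W x‖ ≤ K * min 1 (x₀ - x) := by
    rcases min_choice 1 (x₀ - x) with h' | h' <;> rw [h']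
    · rw [mul_one]
      exact (hK x hx.le).1
    · exact hle
  have h3 : |f (φ x)| * ‖W x‖ ≤ C * K * |frontFlux D φ x| := by
    have h4 := mul_le_mul_of_nonneg_left hW (abs_nonneg (f (φ x)))
    have h5 := mul_le_mul_of_nonneg_left (hfC x hx) hK0
    linarith
  have h4 : ‖fluxWronskian D f φ W W₁ x‖ ≤ (K + C * K) * |frontFlux D φ x| := by
    refine (norm_add_le _ _).trans ?_
    rw [norm_mul, norm_mul, Complex.norm_real, Complex.norm_real, Real.norm_eq_abs,
      Real.norm_eq_abs]
    have := mul_le_mul_of_nonneg_left (hK x hx.le).2 (abs_nonneg (frontFlux D φ x))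
    linarith
  rw [norm_mul, RCLike.norm_conj, norm_div, Complex.norm_real, Real.norm_eq_abs,
    div_mul_eq_mul_div, div_le_iff₀ hp']
  have := mul_le_mul_of_nonneg_left h4 (norm_nonneg (W x))
  linarith

/-- Eigenvalues with an eigenfunction on the support of the front are real and nonpositive. -/
theorem real_and_nonpos (h : IsEdgeSolution D f φ x₀ z 0 W W₁)
    (hD : IsDegenerateDiffusivity D) (hf : IsBistable f α)
    (hDf : ∫ u in (0 : ℝ)..1, D u * f u = 0) (hφ : IsStationaryFront D f φ)
    (h₁ : ∀ x < x₀, 0 < φ x) (h₂ : ∀ x, x₀ ≤ x → φ x = 0) {y : ℝ} (hy : y < x₀)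
    (hW : W y ≠ 0) : z.im = 0 ∧ z.re ≤ 0 := by
  set F : ℝ → ℂ := fun y => starRingEnd ℂ (W y / (frontFlux D φ y : ℂ)) *
        fluxWronskian D f φ W W₁ y with hF
  have hderiv : ∀ x < x₀, HasDerivAt F
      (((‖fluxWronskian D f φ W W₁ x‖ ^ 2 / frontFlux D φ x ^ 2 : ℝ) : ℂ) +
        z * ((‖W x‖ ^ 2 / D (φ x) : ℝ) : ℂ)) x := fun x hx =>
    h.hasDerivAt_form hD hf hφ h₁ hx (hφ.flux_neg hD hf hDf (h₁ x hx)).ne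
  obtain ⟨K, hK, hFK⟩ := h.exists_norm_form_le hD hf hDf hφ h₁ h₂
  have lb : Tendsto F atBot (𝓝 0) := by
    have := h.tendsto_atBot.norm.const_mul K
    rw [norm_zero, mul_zero] at this
    exact squeeze_zero_norm' ((eventually_lt_atBot x₀).mono fun x hx => (hFK x hx).1) this
  have lt : Tendsto F (𝓝[<] x₀) (𝓝 0) := by
    have := (((h.hasDerivAt x₀).continuousAt.tendsto).norm.const_mul K).mono_left
      (nhdsWithin_le_nhds (s := Iio x₀))
    rw [h.edge, norm_zero, mul_zero] at this
    exact squeeze_zero_norm' (eventually_mem_nhdsWithin.mono fun x hx => (hFK x hx).1) this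
  have hDp : ∀ x < x₀, 0 < D (φ x) := fun x hx => hD.pos _ ⟨h₁ x hx, (hφ.mem_Icc x).2⟩
  have hpos : 0 < ‖W y‖ ^ 2 / D (φ y) :=
    div_pos (pow_pos (norm_pos_iff.2 hW) 2) (hDp y hy)
  have him : z.im = 0 := by
    by_contra hz
    -- The extra factor `z.im` makes the derivative `(z.im)² |W|²/D(φ)` nonnegative whatever the
    -- sign of `z.im`.
    have key := (eq_zero_of_deriv_nonneg_of_tendsto (g := fun x => z.im * (F x).im)
      (g' := fun x => z.im * (z.im * (‖W x‖ ^ 2 / D (φ x))))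
      (fun x hx => by
        refine ((Complex.imCLM.hasFDerivAt.comp_hasDerivAt x (hderiv x hx)).const_mul
          z.im).congr_deriv ?_
        simp [-Complex.ofReal_div, -Complex.ofReal_pow])
      (fun x hx => by
        rw [← mul_assoc]
        exact mul_nonneg (mul_self_nonneg _) (div_nonneg (sq_nonneg _) (hDp x hx).le))
      (by simpa using ((Complex.continuous_im.tendsto _).comp lb).const_mul z.im)
      (by simpa using ((Complex.continuous_im.tendsto _).comp lt).const_mul z.im) hy).2
    rcases mul_eq_zero.1 key with h' | h'
    · exact hz h'
    · rcases mul_eq_zero.1 h' with h' | h'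
      · exact hz h'
      · exact hpos.ne' h'
  refine ⟨him, ?_⟩
  by_contra! hz
  have key := (eq_zero_of_deriv_nonneg_of_tendsto (g := fun x => (F x).re)
    (g' := fun x => ‖fluxWronskian D f φ W W₁ x‖ ^ 2 / frontFlux D φ x ^ 2 +
      z.re * (‖W x‖ ^ 2 / D (φ x)))
    (fun x hx => by
      refine (Complex.reCLM.hasFDerivAt.comp_hasDerivAt x (hderiv x hx)).congr_deriv ?_
      simp [-Complex.ofReal_div, -Complex.ofReal_pow])
    (fun x hx => add_nonneg (by positivity)
      (mul_nonneg hz.le (div_nonneg (sq_nonneg _) (hDp x hx).le)))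
    (by simpa [Function.comp_def] using (Complex.continuous_re.tendsto _).comp lb)
    (by simpa [Function.comp_def] using (Complex.continuous_re.tendsto _).comp lt) hy).2
  have h5 : 0 ≤ ‖fluxWronskian D f φ W W₁ y‖ ^ 2 / frontFlux D φ y ^ 2 := by positivity
  have h6 := mul_pos hz hpos
  linarith

end IsEdgeSolution

/-! ### The spectral gap -/

/-- A primitive of `φ_x · D(φ) φ_x`. -/
theorem IsStationaryFront.exists_action {D f φ : ℝ → ℝ} {α x₀ : ℝ}
    (hφ : IsStationaryFront D f φ) (hD : IsDegenerateDiffusivity D) (hf : IsBistable f α)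
    (hDf : ∫ u in (0 : ℝ)..1, D u * f u = 0) (h₂ : ∀ x, x₀ ≤ x → φ x = 0) :
    ∃ (S : ℝ → ℝ) (A : ℝ), 0 < A ∧ (∀ x, HasDerivAt S (deriv φ x * frontFlux D φ x) x) ∧
      Tendsto S atBot (𝓝 (-A)) ∧ Tendsto S (𝓝[<] x₀) (𝓝 0) := by
  have hc : ContinuousOn (fun s => √(frontPotential D f s)) (Icc 0 1) :=
    (continuousOn_frontPotential hD hf).sqrt
  have hcE : Continuous (IccExtend zero_le_one
      (fun r : Icc (0 : ℝ) 1 => √(frontPotential D f r))) := hc.domRestrict.Icc_extend'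
  set E := IccExtend zero_le_one (fun r : Icc (0 : ℝ) 1 => √(frontPotential D f r)) with hE
  have hEs : ∀ s ∈ Icc (0 : ℝ) 1, E s = √(frontPotential D f s) := fun s hs =>
    IccExtend_of_mem zero_le_one (fun r : Icc (0 : ℝ) 1 => √(frontPotential D f r)) hs
  set A : ℝ → ℝ := fun s => ∫ t in (0 : ℝ)..s, E t with hA
  have hAd : ∀ s, HasDerivAt A (E s) s := fun s => (hcE.integral_hasStrictDerivAt 0 s).hasDerivAt
  have hAc : Continuous A := continuous_iff_continuousAt.2 fun s => (hAd s).continuousAt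
  -- Since `P = -√G(φ)`, a primitive of `φ_x P` is minus the primitive of `√G` composed with `φ`,
  -- and its total increase is `∫₀¹ √G`.
  refine ⟨fun x => -A (φ x), A 1, ?_, fun x => ?_, ?_, ?_⟩
  · refine intervalIntegral.intervalIntegral_pos_of_pos_on (hcE.intervalIntegrable _ _)
      (fun s hs => ?_) zero_lt_one
    rw [hEs s (Ioo_subset_Icc_self hs)]
    exact Real.sqrt_pos.2 (frontPotential_pos hD hf hDf hs)
  · refine ((hAd (φ x)).comp x (hφ.hasDerivAt x)).neg.congr_deriv ?_
    rw [hEs _ (hφ.mem_Icc x), ← hφ.flux_sq hD hf hDf, Real.sqrt_sq_eq_abs,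
      abs_of_nonpos (hφ.flux_nonpos hD x)]
    ring
  · exact ((hAc.tendsto 1).comp hφ.tendsto_atBot).neg
  · have h3 : Tendsto (fun x => -A (φ x)) (𝓝 x₀) (𝓝 (-A (φ x₀))) :=
      ((hAc.comp hφ.continuous).neg).tendsto x₀
    rw [h₂ x₀ le_rfl, show A 0 = 0 by simp [hA], neg_zero] at h3
    exact h3.mono_left nhdsWithin_le_nhds

namespace IsEdgeSolution

variable {D f φ : ℝ → ℝ} {α x₀ : ℝ} {z c : ℂ} {W W₁ : ℝ → ℂ}

/-- From `|q'| ≤ |z| N |φ_x|`, integration from `-∞` gives the factor `1 - φ` and integration from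
the edge the factor `φ`. The smaller of the two is at most `2 φ (1 - φ)`. -/
theorem norm_wronskian_le_of_bound (h : IsEdgeSolution D f φ x₀ z 0 W W₁)
    (hD : IsDegenerateDiffusivity D) (hf : IsBistable f α)
    (hDf : ∫ u in (0 : ℝ)..1, D u * f u = 0) (hφ : IsStationaryFront D f φ)
    (h₁ : ∀ x < x₀, 0 < φ x) (h₂ : ∀ x, x₀ ≤ x → φ x = 0) {N : ℝ}
    (hN : ∀ x < x₀, ‖W x‖ ≤ N) {x : ℝ} (hx : x < x₀) :
    ‖fluxWronskian D f φ W W₁ x‖ ≤ 2 * (‖z‖ * N) * (φ x * (1 - φ x)) := by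
  have hN0 : 0 ≤ ‖z‖ * N := mul_nonneg (norm_nonneg _) ((norm_nonneg _).trans (hN x hx))
  have hsub : ∀ {a b : ℝ}, a ≤ b → b < x₀ →
      ‖fluxWronskian D f φ W W₁ b - fluxWronskian D f φ W W₁ a‖ ≤ ‖z‖ * N * (φ a - φ b) := by
    intro a b hab hb
    have := norm_sub_le_sub_of_norm_deriv_le (g := fun y => ‖z‖ * N * -φ y)
      (fun t ht => h.hasDerivAt_wronskian hD hf hφ h₁ ht)
      (fun t _ => ((hφ.hasDerivAt t).neg).const_mul (‖z‖ * N))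
      (fun t ht => by
        rw [zero_mul, add_zero, norm_mul, norm_mul, Complex.norm_real, Real.norm_eq_abs,
          abs_of_nonpos (hφ.deriv_nonpos t), mul_comm]
        exact mul_le_mul_of_nonneg_right (mul_le_mul_of_nonneg_left (hN t ht) (norm_nonneg _))
          (by linarith [hφ.deriv_nonpos t])) hab hb
    linarith
  have hleft : ‖fluxWronskian D f φ W W₁ x‖ ≤ ‖z‖ * N * (1 - φ x) := by
    have t1 := ((h.tendsto_wronskian_atBot hD hf hDf hφ).const_sub
      (fluxWronskian D f φ W W₁ x)).norm
    rw [sub_zero] at t1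
    exact le_of_tendsto_of_tendsto t1 ((hφ.tendsto_atBot.sub_const (φ x)).const_mul (‖z‖ * N))
      ((eventually_le_atBot x).mono fun a ha => hsub ha hx)
  have hright : ‖fluxWronskian D f φ W W₁ x‖ ≤ ‖z‖ * N * φ x := by
    have t1 := ((h.tendsto_wronskian_edge hf hφ h₂).sub_const
      (fluxWronskian D f φ W W₁ x)).norm
    rw [zero_sub, norm_neg] at t1
    have t2 : Tendsto (fun b => ‖z‖ * N * (φ x - φ b)) (𝓝[<] x₀) (𝓝 (‖z‖ * N * (φ x - φ x₀))) :=
      (((hφ.continuous.tendsto x₀).const_sub (φ x)).const_mul (‖z‖ * N)).mono_left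
        nhdsWithin_le_nhds
    rw [h₂ x₀ le_rfl, sub_zero] at t2
    exact le_of_tendsto_of_tendsto t1 t2
      ((eventually_nhdsLT_lt_lt hx).mono fun b hb => hsub hb.1.le hb.2)
  have hm := hφ.mem_Icc x
  rcases le_total (φ x) (1 / 2) with h' | h'
  · refine hright.trans ?_
    have : 0 ≤ ‖z‖ * N * φ x * (1 - 2 * φ x) :=
      mul_nonneg (mul_nonneg hN0 hm.1) (by linarith)
    linarith
  · refine hleft.trans ?_
    have : 0 ≤ ‖z‖ * N * (1 - φ x) * (2 * φ x - 1) :=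
      mul_nonneg (mul_nonneg hN0 (by linarith [hm.2])) (by linarith)
    linarith

/-- Up to a multiple of the flux, a bounded solution is small when the eigenvalue is small. -/
theorem exists_norm_sub_mul_flux_le (h : IsEdgeSolution D f φ x₀ z 0 W W₁)
    (hD : IsDegenerateDiffusivity D) (hf : IsBistable f α)
    (hDf : ∫ u in (0 : ℝ)..1, D u * f u = 0) (hφ : IsStationaryFront D f φ)
    (h₁ : ∀ x < x₀, 0 < φ x) (h₂ : ∀ x, x₀ ≤ x → φ x = 0) {κ : ℝ} (hκ : 0 < κ)
    (hG : ∀ s ∈ Ioo (0 : ℝ) 1, κ * (s * (1 - s)) ≤ frontPotential D f s / D s + (s - α) * f s)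
    {N : ℝ} (hN : ∀ x < x₀, ‖W x‖ ≤ N) :
    ∃ k : ℂ, ∀ x < x₀, ‖W x - k * (frontFlux D φ x : ℂ)‖ ≤ 2 * (‖z‖ * N) / κ := by
  obtain ⟨a, ha⟩ := hφ.exists_eq hf.mem_Ioo
  have hax : a < x₀ := by
    by_contra hn
    have := h₂ a (not_lt.1 hn)
    linarith [hf.mem_Ioo.1]
  have hneg : ∀ x < x₀, frontFlux D φ x < 0 := fun x hx => hφ.flux_neg hD hf hDf (h₁ x hx)
  have hR : 0 ≤ 2 * (‖z‖ * N) / κ := by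
    have := (norm_nonneg _).trans (hN a hax)
    positivity
  set R := 2 * (‖z‖ * N) / κ with hRdef
  have hDp : ∀ x < x₀, 0 < D (φ x) := fun x hx => hD.pos _ ⟨h₁ x hx, (hφ.mem_Icc x).2⟩
  -- The majorant of `W / P`: it vanishes at the point `a` with `φ(a) = α`, its derivative is
  -- computed from `φ_x P = G(φ)/D(φ)`, and after multiplication by `P` it stays bounded although
  -- `1/P` does not.
  have hΨ : ∀ x < x₀, HasDerivAt (fun y => R * ((φ y - α) / frontFlux D φ y))
      (R * ((frontPotential D f (φ x) / D (φ x) + (φ x - α) * f (φ x)) /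
        frontFlux D φ x ^ 2)) x := by
    intro x hx
    refine ((((hφ.hasDerivAt x).sub_const α).div (hφ.hasDerivAt_flux x)
      (hneg x hx).ne).const_mul R).congr_deriv ?_
    rw [← hφ.flux_sq hD hf hDf]
    have h3 := (hDp x hx).ne'
    have h4 : deriv φ x * frontFlux D φ x = frontFlux D φ x ^ 2 / D (φ x) := by
      rw [frontFlux]
      field_simp
    rw [h4]
    ring
  have hsub : ∀ {s t : ℝ}, s ≤ t → t < x₀ →
      ‖W t / (frontFlux D φ t : ℂ) - W s / (frontFlux D φ s : ℂ)‖ ≤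
        R * ((φ t - α) / frontFlux D φ t) - R * ((φ s - α) / frontFlux D φ s) := by
    intro s t hst ht
    refine norm_sub_le_sub_of_norm_deriv_le
      (fun y hy => h.hasDerivAt_div_flux hφ (hneg y hy).ne) hΨ (fun y hy => ?_) hst ht
    have h3 := h.norm_wronskian_le_of_bound hD hf hDf hφ h₁ h₂ hN hy
    have h4 := hG (φ y) ⟨h₁ y hy, hφ.lt_one hD hf hDf y⟩
    have h5 : 0 < frontFlux D φ y ^ 2 := by have := (hneg y hy).ne; positivity
    rw [norm_div, norm_pow, Complex.norm_real, Real.norm_eq_abs, sq_abs, ← mul_div_assoc]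
    refine div_le_div_of_nonneg_right (h3.trans ?_) h5.le
    calc 2 * (‖z‖ * N) * (φ y * (1 - φ y)) = R * (κ * (φ y * (1 - φ y))) := by
          rw [hRdef]
          field_simp
      _ ≤ _ := mul_le_mul_of_nonneg_left h4 hR
  refine ⟨W a / (frontFlux D φ a : ℂ), fun x hx => ?_⟩
  have hp := hneg x hx
  have hkey : ‖W x / (frontFlux D φ x : ℂ) - W a / (frontFlux D φ a : ℂ)‖ ≤
      R * (|φ x - α| / |frontFlux D φ x|) := by
    rw [← abs_div]
    rcases le_total a x with hle | hle
    · have h3 := hsub hle hx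
      rw [ha, sub_self, zero_div, mul_zero, sub_zero] at h3
      exact h3.trans (mul_le_mul_of_nonneg_left (le_abs_self _) hR)
    · have h3 := hsub hle hax
      rw [ha, sub_self, zero_div, mul_zero, zero_sub, ← mul_neg, norm_sub_rev] at h3
      exact h3.trans (mul_le_mul_of_nonneg_left (neg_le_abs _) hR)
  have hp' : 0 < |frontFlux D φ x| := abs_pos.2 hp.ne
  have heq : W x - W a / (frontFlux D φ a : ℂ) * (frontFlux D φ x : ℂ) =
      (W x / (frontFlux D φ x : ℂ) - W a / (frontFlux D φ a : ℂ)) * (frontFlux D φ x : ℂ) := by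
    rw [sub_mul, div_mul_cancel₀ _ (Complex.ofReal_ne_zero.2 hp.ne)]
  rw [heq, norm_mul, Complex.norm_real, Real.norm_eq_abs]
  have hα1 : |φ x - α| ≤ 1 := by
    have := hφ.mem_Icc x
    have := hf.mem_Ioo
    rw [abs_le]
    constructor <;> linarith [this.1, this.2, (hφ.mem_Icc x).1, (hφ.mem_Icc x).2]
  calc _ ≤ R * (|φ x - α| / |frontFlux D φ x|) * |frontFlux D φ x| :=
        mul_le_mul_of_nonneg_right hkey hp'.le
    _ = R * |φ x - α| := by field_simp
    _ ≤ R := mul_le_of_le_one_right hR hα1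

/-- Because `q` vanishes at both ends and `z ≠ 0`, `W` satisfies `∫ φ_x W = 0`. Hence `k ∫ φ_x P =
-∫ φ_x (W - k P)`, where the left integral is `A` and `∫ |φ_x| = 1`. The function `Q` below encodes
this without integrals. -/
theorem norm_mul_action_le (h : IsEdgeSolution D f φ x₀ z 0 W W₁)
    (hD : IsDegenerateDiffusivity D) (hf : IsBistable f α)
    (hDf : ∫ u in (0 : ℝ)..1, D u * f u = 0) (hφ : IsStationaryFront D f φ)
    (h₁ : ∀ x < x₀, 0 < φ x) (h₂ : ∀ x, x₀ ≤ x → φ x = 0) (hz : z ≠ 0) {S : ℝ → ℝ} {A : ℝ}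
    (hA : 0 < A) (hS : ∀ x, HasDerivAt S (deriv φ x * frontFlux D φ x) x)
    (hSb : Tendsto S atBot (𝓝 (-A))) (hSt : Tendsto S (𝓝[<] x₀) (𝓝 0)) {k : ℂ} {R : ℝ}
    (hR : ∀ x < x₀, ‖W x - k * (frontFlux D φ x : ℂ)‖ ≤ R) : ‖k‖ * A ≤ R := by
  set Q : ℝ → ℂ := fun x => fluxWronskian D f φ W W₁ x / z - k * (S x : ℂ) with hQ
  have hR0 : 0 ≤ R := (norm_nonneg _).trans (hR _ (sub_one_lt x₀))
  have hQd : ∀ x < x₀, HasDerivAt Q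
      (((deriv φ x : ℝ) : ℂ) * (W x - k * (frontFlux D φ x : ℂ))) x := by
    intro x hx
    refine (((h.hasDerivAt_wronskian hD hf hφ h₁ hx).div_const z).sub
      ((hS x).ofReal_comp.const_mul k)).congr_deriv ?_
    push_cast
    field_simp
    ring
  have hsub : ∀ {a b : ℝ}, a ≤ b → b < x₀ → ‖Q b - Q a‖ ≤ R := by
    intro a b hab hb
    have := norm_sub_le_sub_of_norm_deriv_le (g := fun y => R * -φ y) hQd
      (fun t _ => ((hφ.hasDerivAt t).neg).const_mul R)
      (fun t ht => by
        rw [norm_mul, Complex.norm_real, Real.norm_eq_abs,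
          abs_of_nonpos (hφ.deriv_nonpos t), mul_comm]
        exact mul_le_mul_of_nonneg_right (hR t ht) (by linarith [hφ.deriv_nonpos t])) hab hb
    have h3 := mul_nonneg hR0 (hφ.mem_Icc b).1
    have h4 := mul_le_mul_of_nonneg_left (hφ.mem_Icc a).2 hR0
    linarith
  have cS : ∀ {l : Filter ℝ} {s : ℝ}, Tendsto S l (𝓝 s) →
      Tendsto (fun x => (S x : ℂ)) l (𝓝 (s : ℂ)) := fun hs =>
    (Complex.continuous_ofReal.tendsto _).comp hs
  have lb : Tendsto Q atBot (𝓝 (k * A)) := by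
    have := ((h.tendsto_wronskian_atBot hD hf hDf hφ).div_const z).sub ((cS hSb).const_mul k)
    simpa using this
  have lt : Tendsto Q (𝓝[<] x₀) (𝓝 0) := by
    have := ((h.tendsto_wronskian_edge hf hφ h₂).div_const z).sub ((cS hSt).const_mul k)
    simpa using this
  have hQa : ∀ a < x₀, ‖Q a‖ ≤ R := by
    intro a ha
    have t1 := (lt.sub_const (Q a)).norm
    rw [zero_sub, norm_neg] at t1
    exact le_of_tendsto t1 ((eventually_nhdsLT_lt_lt ha).mono fun b hb => hsub hb.1.le hb.2)
  have := le_of_tendsto lb.norm ((eventually_lt_atBot x₀).mono hQa)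
  rwa [norm_mul, Complex.norm_real, Real.norm_eq_abs, abs_of_pos hA] at this

theorem exists_gap (hD : IsDegenerateDiffusivity D) (hf : IsBistable f α)
    (hDf : ∫ u in (0 : ℝ)..1, D u * f u = 0) (hφ : IsStationaryFront D f φ)
    (h₁ : ∀ x < x₀, 0 < φ x) (h₂ : ∀ x, x₀ ≤ x → φ x = 0) :
    ∃ μ : ℝ, 0 < μ ∧ ∀ (z : ℂ) (W W₁ : ℝ → ℂ), IsEdgeSolution D f φ x₀ z 0 W W₁ → z ≠ 0 →
      ‖z‖ < μ → ∀ x < x₀, W x = 0 := by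
  obtain ⟨κ, hκ, hG⟩ := exists_mul_le_frontPotential_div_add hD hf hDf
  obtain ⟨S, A, hA, hS, hSb, hSt⟩ := hφ.exists_action hD hf hDf h₂
  obtain ⟨C, hC, hpC⟩ := hφ.exists_abs_flux_le hD hf hDf
  -- With `R = 2|z|N/κ`, `|k| ≤ R/A` and `|P| ≤ C`, one gets `N ≤ R + |k| C ≤ |z| M N`.
  set M := 2 / κ * (C / A + 1) with hM
  have hMpos : 0 < M := by positivity
  refine ⟨M⁻¹, by positivity, fun z W W₁ h hz hzμ => ?_⟩
  obtain ⟨K, hK⟩ := h.bounded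
  have : Nonempty (Iio x₀) := ⟨⟨x₀ - 1, sub_one_lt x₀⟩⟩
  have hbdd : BddAbove (range fun x : Iio x₀ => ‖W x‖) :=
    ⟨K, by rintro _ ⟨x, rfl⟩; exact (hK x x.2.le).1⟩
  set N := ⨆ x : Iio x₀, ‖W x‖ with hNdef
  have hN : ∀ x < x₀, ‖W x‖ ≤ N := fun x hx => le_ciSup hbdd ⟨x, hx⟩
  obtain ⟨k, hk⟩ := h.exists_norm_sub_mul_flux_le hD hf hDf hφ h₁ h₂ hκ hG hN
  have hkA := h.norm_mul_action_le hD hf hDf hφ h₁ h₂ hz hA hS hSb hSt hk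
  rw [← le_div_iff₀ hA] at hkA
  have hN0 : 0 ≤ N := (norm_nonneg _).trans (hN _ (sub_one_lt x₀))
  have hle : N ≤ ‖z‖ * M * N := by
    refine ciSup_le fun x => ?_
    have h3 : ‖W x‖ ≤ ‖W x - k * (frontFlux D φ x : ℂ)‖ + ‖k‖ * |frontFlux D φ x| := by
      rw [← Real.norm_eq_abs, ← Complex.norm_real, ← norm_mul]
      simpa using norm_add_le (W x - k * (frontFlux D φ x : ℂ)) (k * (frontFlux D φ x : ℂ))
    have h4 : ‖k‖ * |frontFlux D φ x| ≤ 2 * (‖z‖ * N) / κ / A * C :=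
      mul_le_mul hkA (hpC x) (abs_nonneg _) (by positivity)
    have h5 := hk x x.2
    have h6 : ‖z‖ * M * N = 2 * (‖z‖ * N) / κ + 2 * (‖z‖ * N) / κ / A * C := by
      rw [hM]
      field_simp
      ring
    linarith
  have hlt : ‖z‖ * M < 1 := by
    rwa [← one_div, lt_div_iff₀ hMpos] at hzμ
  have hNz : N ≤ 0 := by
    by_contra hn
    have := mul_lt_mul_of_pos_right hlt (not_le.1 hn)
    linarith
  exact fun x hx => norm_le_zero_iff.1 ((hN x hx).trans hNz)

end IsEdgeSolution

/-! ### From the domain of the operator to classical solutions -/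

/-- Both `g²` and its derivative `2 g g'` are integrable. -/
theorem tendsto_zero_atBot_of_memLp_two {a : ℝ} {g g' : ℝ → ℂ}
    (hd : ∀ x ≤ a, HasDerivAt g (g' x) x) (hg : MemLp g 2 volume) (hg' : MemLp g' 2 volume) :
    Tendsto g atBot (𝓝 0) := by
  have h1 : Integrable fun x => g x ^ 2 := by
    simp only [sq]
    exact hg.integrable_mul hg
  have h2 : Integrable fun x => 2 * g x ^ (2 - 1) * g' x := by
    simpa [mul_assoc] using (hg.integrable_mul hg').const_mul 2
  have h3 := tendsto_zero_of_hasDerivAt_of_integrableOn_Iic (a := a) (f := fun x => g x ^ 2)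
    (fun x hx => (hd x hx).pow 2) h2.integrableOn h1.integrableOn
  have h4 := h3.norm.sqrt
  simp only [norm_pow, Real.sqrt_sq (norm_nonneg _), norm_zero, Real.sqrt_zero] at h4
  exact tendsto_zero_iff_norm_tendsto_zero.2 h4

theorem Continuous.exists_norm_le_Iic_of_tendsto_zero {g : ℝ → ℂ} (hg : Continuous g)
    (ht : Tendsto g atBot (𝓝 0)) (b : ℝ) : ∃ K, ∀ x ≤ b, ‖g x‖ ≤ K := by
  have h1 := ht.norm
  rw [norm_zero] at h1
  obtain ⟨a, ha⟩ := eventually_atBot.1 (h1.eventually (gt_mem_nhds one_pos))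
  obtain ⟨K, hK⟩ := isCompact_Icc.exists_bound_of_continuousOn (hg.continuousOn (s := Icc a b))
  refine ⟨max 1 K, fun x hx => ?_⟩
  rcases le_total x a with h | h
  · exact (ha x h).le.trans (le_max_left _ _)
  · exact (hK x ⟨h, hx⟩).trans (le_max_right _ _)

/-- Regularity: the continuous representative `W` vanishes beyond the edge because `D(φ)` does. Left
of it the second weak derivative agrees almost everywhere with a continuous function, so `W₁` is
classically differentiable. Decay at `-∞` and boundedness follow from square integrability. -/
theorem exists_isEdgeSolution {D f φ : ℝ → ℝ} {α x₀ : ℝ} (hD : IsDegenerateDiffusivity D)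
    (hf : IsBistable f α) (hφ : IsStationaryFront D f φ)
    (h₁ : ∀ x < x₀, 0 < φ x) (h₂ : ∀ x, x₀ ≤ x → φ x = 0) {u v : ℝ → ℂ} {z c : ℂ}
    (h : IsH2WithSecondDeriv (diffMul D φ u) v)
    (hv : v =ᵐ[volume] fun x => z * u x + c * (deriv φ x : ℝ) - reactMul f φ u x) :
    ∃ W W₁ : ℝ → ℂ, diffMul D φ u =ᵐ[volume] W ∧ IsEdgeSolution D f φ x₀ z c W W₁ ∧
      ∀ x, x₀ ≤ x → W x = 0 := by
  obtain ⟨W, W₁, k, hW, hd, hW₁, hc₁, m1, m2⟩ := h.exists_representative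
  have hDp : ∀ x < x₀, 0 < D (φ x) := fun x hx => hD.pos _ ⟨h₁ x hx, (hφ.mem_Icc x).2⟩
  have hWc : Continuous W := continuous_iff_continuousAt.2 fun x => (hd x).continuousAt
  have hW0 : ∀ x, x₀ < x → W x = 0 := by
    have hae : W =ᵐ[volume.restrict (Ioi x₀)] fun _ => 0 := by
      filter_upwards [ae_restrict_of_ae hW, ae_restrict_mem measurableSet_Ioi] with x hx hx0
      rw [← hx, diffMul, h₂ x (le_of_lt hx0), hD.map_zero, Complex.ofReal_zero, zero_mul]
    exact Measure.eqOn_open_of_ae_eq hae isOpen_Ioi hWc.continuousOn continuousOn_const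
  have hedge : W x₀ = 0 := by
    have t1 : Tendsto W (𝓝[>] x₀) (𝓝 (W x₀)) := (hWc.tendsto x₀).mono_left nhdsWithin_le_nhds
    refine tendsto_nhds_unique t1 (tendsto_const_nhds.congr' ?_)
    exact eventually_mem_nhdsWithin.mono fun x hx => (hW0 x hx).symm
  classical
  set F : ℝ → ℂ := fun x => (z - (derivWithin f (Icc 0 1) (φ x) : ℝ)) * (W x / (D (φ x) : ℝ)) +
    c * (deriv φ x : ℝ) with hF
  -- `V` is `v` with its values corrected on a null set so as to be continuous left of the edge; no
  -- regularity of it is needed to the right.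
  set V : ℝ → ℂ := fun x => if x < x₀ then F x else v x with hV
  have hvV : v =ᵐ[volume] V := by
    filter_upwards [hv, hW] with x hx hWx
    simp only [hV]
    split_ifs with hlt
    · have hne : ((D (φ x) : ℝ) : ℂ) ≠ 0 := Complex.ofReal_ne_zero.2 (hDp x hlt).ne'
      simp only [hx, hF, ← hWx, diffMul, reactMul]
      rw [mul_div_cancel_left₀ _ hne]
      ring
    · rfl
  have mV : MemLp V 2 volume := (memLp_congr_ae hvV).1 h.2.1
  have lV := mV.locallyIntegrable (by norm_num : (1 : ENNReal) ≤ 2)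
  have hFc : ∀ x < x₀, ContinuousAt F x := by
    intro x hx
    have hne : ((D (φ x) : ℝ) : ℂ) ≠ 0 := Complex.ofReal_ne_zero.2 (hDp x hx).ne'
    have cD : Continuous fun y => ((D (φ y) : ℝ) : ℂ) :=
      Complex.continuous_ofReal.comp (hφ.continuous_comp hD.contDiffOn.continuousOn)
    have cf : Continuous fun y => ((derivWithin f (Icc 0 1) (φ y) : ℝ) : ℂ) :=
      Complex.continuous_ofReal.comp
        (hφ.continuous_comp hf.contDiffOn.continuousOn_derivWithin_unit)
    -- The front is only assumed differentiable; continuity of `φ_x` left of the edge comes from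
    -- `φ_x = P / D(φ)`.
    have cφ : ContinuousAt (fun y => ((deriv φ y : ℝ) : ℂ)) x := by
      have h3 : ContinuousAt (fun y => (frontFlux D φ y : ℂ) / ((D (φ y) : ℝ) : ℂ)) x :=
        (Complex.continuous_ofReal.comp hφ.continuous_flux).continuousAt.div cD.continuousAt hne
      refine h3.congr ?_
      filter_upwards [Iio_mem_nhds hx] with y hy
      have := (hDp y hy).ne'
      rw [frontFlux, Complex.ofReal_mul, mul_div_cancel_left₀ _ (Complex.ofReal_ne_zero.2 this)]
    exact ((continuousAt_const.sub cf.continuousAt).mul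
      (hWc.continuousAt.div cD.continuousAt hne)).add (continuousAt_const.mul cφ)
  have hd₁ : ∀ x < x₀, HasDerivAt W₁ (V x) x := by
    intro x hx
    have hW₁' : W₁ = fun x => k + ∫ t in (0 : ℝ)..x, V t := funext fun y => by
      rw [hW₁ y, intervalIntegral.integral_congr_ae (hvV.mono fun t ht _ => ht)]
    rw [hW₁']
    refine (intervalIntegral.integral_hasDerivAt_right ?_
      mV.aestronglyMeasurable.stronglyMeasurableAtFilter ?_).const_add k
    · rw [intervalIntegrable_iff]
      exact (lV.integrableOn_isCompact isCompact_uIcc).mono_set uIoc_subset_uIcc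
    · refine (hFc x hx).congr ?_
      filter_upwards [Iio_mem_nhds hx] with y hy
      exact (if_pos hy).symm
  have t0 : Tendsto W atBot (𝓝 0) :=
    tendsto_zero_atBot_of_memLp_two (a := 0) (fun x _ => hd x) m1 m2
  have t1 : Tendsto W₁ atBot (𝓝 0) :=
    tendsto_zero_atBot_of_memLp_two (a := x₀ - 1) (fun x hx => hd₁ x (by linarith)) m2 mV
  obtain ⟨K, hK⟩ := hWc.exists_norm_le_Iic_of_tendsto_zero t0 x₀
  obtain ⟨K', hK'⟩ := hc₁.exists_norm_le_Iic_of_tendsto_zero t1 x₀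
  refine ⟨W, W₁, hW, ⟨hd, fun x hx => ?_, hedge, t0, max K K', fun x hx =>
    ⟨(hK x hx).trans (le_max_left _ _), (hK' x hx).trans (le_max_right _ _)⟩⟩, fun x hx => ?_⟩
  · have := hd₁ x hx
    rwa [show V x = F x from if_pos hx] at this
  · rcases hx.eq_or_lt with hlt | hlt
    · rw [← hlt, hedge]
    · exact hW0 x hlt

/-! ### Spectral properties of the linearized operator -/

section Linearized

variable {D f φ : ℝ → ℝ} {α x₀ : ℝ}

theorem exists_isEdgeSolution_of_apply_eq (hD : IsDegenerateDiffusivity D)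
    (hf : IsBistable f α) (hφ : IsStationaryFront D f φ)
    (hL : MemLp (fun x => ((deriv φ x : ℝ) : ℂ)) 2 volume)
    (h₁ : ∀ x < x₀, 0 < φ x) (h₂ : ∀ x, x₀ ≤ x → φ x = 0) {z c : ℂ}
    (u : (linearizedOp hf hφ).domain)
    (hu : linearizedOp hf hφ u = z • (u : L2) + c • hL.toLp) :
    ∃ W W₁ : ℝ → ℂ, diffMul D φ u.1 =ᵐ[volume] W ∧ IsEdgeSolution D f φ x₀ z c W W₁ ∧
      ∀ x, x₀ ≤ x → W x = 0 := by
  refine exists_isEdgeSolution hD hf hφ h₁ h₂ ((linearizedOp_eq_iff hf hφ u _).1 hu) ?_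
  filter_upwards [Lp.coeFn_add (z • (u : L2)) (c • hL.toLp), Lp.coeFn_smul z (u : L2),
    Lp.coeFn_smul c hL.toLp, hL.coeFn_toLp] with x e1 e2 e3 e4
  rw [Pi.sub_apply, e1, Pi.add_apply, e2, e3, Pi.smul_apply, Pi.smul_apply, e4, smul_eq_mul,
    smul_eq_mul]

/-- Where `φ > 0` one divides by `D(φ)`. Where `φ = 0` the second-derivative term is zero and the
equation reads `(z - f'(0)) u = 0`, which is why `f'(0)` is excluded. -/
theorem eq_zero_of_diffMul_ae_eq_zero (hD : IsDegenerateDiffusivity D)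
    (hf : IsBistable f α) (hφ : IsStationaryFront D f φ) {z : ℂ}
    (hz : z ≠ ((derivWithin f (Icc 0 1) 0 : ℝ) : ℂ)) (u : (linearizedOp hf hφ).domain)
    (hu : linearizedOp hf hφ u = z • (u : L2)) (h0 : diffMul D φ u.1 =ᵐ[volume] 0) :
    (u : L2) = 0 := by
  have h1 := (((linearizedOp_eq_iff hf hφ u _).1 hu).congr h0 .rfl).unique isH2WithSecondDeriv_zero
  refine Lp.ext ?_
  filter_upwards [h0, h1, Lp.coeFn_smul z (u : L2), Lp.coeFn_zero ℂ 2 (volume : Measure ℝ)]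
    with x e0 e1 e2 e3
  rw [e3, Pi.zero_apply]
  rcases (hφ.mem_Icc x).1.eq_or_lt with h | h
  · rw [Pi.sub_apply, e2, Pi.smul_apply, smul_eq_mul, reactMul, ← h, ← sub_mul,
      Pi.zero_apply] at e1
    exact (mul_eq_zero.1 e1).resolve_left (sub_ne_zero.2 hz)
  · exact (mul_eq_zero.1 e0).resolve_left
      (Complex.ofReal_ne_zero.2 (hD.pos _ ⟨h, (hφ.mem_Icc x).2⟩).ne')

theorem diffMul_toLp_deriv_ae_eq (D : ℝ → ℝ)
    (hL : MemLp (fun x => ((deriv φ x : ℝ) : ℂ)) 2 volume) :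
    diffMul D φ hL.toLp =ᵐ[volume] fun x => ((frontFlux D φ x : ℝ) : ℂ) := by
  filter_upwards [hL.coeFn_toLp] with x hx
  rw [diffMul, hx, frontFlux, Complex.ofReal_mul]

theorem isH2WithSecondDeriv_toLp_deriv (hD : IsDegenerateDiffusivity D)
    (hf : IsBistable f α) (hDf : ∫ u in (0 : ℝ)..1, D u * f u = 0) (hφ : IsStationaryFront D f φ)
    (hL : MemLp (fun x => ((deriv φ x : ℝ) : ℂ)) 2 volume) :
    IsH2WithSecondDeriv (diffMul D φ hL.toLp) (⇑(0 : L2) - reactMul f φ hL.toLp) := by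
  refine (hφ.isH2WithSecondDeriv_flux hD hf hDf).congr (diffMul_toLp_deriv_ae_eq D hL).symm ?_
  filter_upwards [hL.coeFn_toLp, Lp.coeFn_zero ℂ 2 (volume : Measure ℝ)] with x e1 e2
  rw [Pi.sub_apply, e2, Pi.zero_apply, zero_sub, reactMul, e1, Complex.ofReal_mul]

theorem toLp_deriv_ne_zero (hD : IsDegenerateDiffusivity D)
    (hf : IsBistable f α) (hDf : ∫ u in (0 : ℝ)..1, D u * f u = 0) (hφ : IsStationaryFront D f φ)
    (hL : MemLp (fun x => ((deriv φ x : ℝ) : ℂ)) 2 volume) : hL.toLp ≠ 0 := by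
  intro h0
  obtain ⟨a, ha⟩ := hφ.exists_eq hf.mem_Ioo
  have hae : frontFlux D φ =ᵐ[volume] fun _ => (0 : ℝ) := by
    filter_upwards [diffMul_toLp_deriv_ae_eq D hL, Lp.coeFn_zero ℂ 2 (volume : Measure ℝ)]
      with x e1 e2
    rw [h0, diffMul, e2, Pi.zero_apply, mul_zero] at e1
    exact Complex.ofReal_eq_zero.1 e1.symm
  have heq := Measure.eq_of_ae_eq hae hφ.continuous_flux continuous_const
  exact (hφ.flux_neg hD hf hDf (x := a) (by rw [ha]; exact hf.mem_Ioo.1)).ne (congrFun heq a)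

theorem shiftedMap_eq_zero_iff {E : Type*} [AddCommGroup E] [Module ℂ E] (T : E →ₗ.[ℂ] E) (z : ℂ)
    (u : T.domain) : shiftedMap T z u = 0 ↔ T u = z • (u : E) :=
  sub_eq_zero (a := T u) (b := z • (u : E))

theorem shiftedMap_zero_apply {E : Type*} [AddCommGroup E] [Module ℂ E] (T : E →ₗ.[ℂ] E)
    (u : T.domain) : shiftedMap T 0 u = T u := by
  simp only [shiftedMap, zero_smul, sub_zero]
  rfl

/-- The kernel of the linearized operator is spanned by the derivative of the front. -/
theorem mem_span_of_apply_eq_zero (hD : IsDegenerateDiffusivity D)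
    (hf : IsBistable f α) (hDf : ∫ u in (0 : ℝ)..1, D u * f u = 0) (hφ : IsStationaryFront D f φ)
    (hL : MemLp (fun x => ((deriv φ x : ℝ) : ℂ)) 2 volume) (u : (linearizedOp hf hφ).domain)
    (hu : linearizedOp hf hφ u = 0) : (u : L2) ∈ Submodule.span ℂ {hL.toLp} := by
  obtain ⟨x₀, h₁, h₂⟩ := hφ.exists_edge hD hf hDf
  have hdom : hL.toLp ∈ (linearizedOp hf hφ).domain :=
    ⟨_, isH2WithSecondDeriv_toLp_deriv hD hf hDf hφ hL⟩
  have hψ : linearizedOp hf hφ ⟨hL.toLp, hdom⟩ = 0 :=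
    (linearizedOp_eq_iff hf hφ _ _).2 (isH2WithSecondDeriv_toLp_deriv hD hf hDf hφ hL)
  obtain ⟨W, W₁, hW, hsol, hzero⟩ := exists_isEdgeSolution_of_apply_eq hD hf hφ hL h₁ h₂
    (z := 0) (c := 0) u (by rw [hu, zero_smul, zero_smul, add_zero])
  obtain ⟨k, hk⟩ := hsol.exists_eq_mul_flux hD hf hDf hφ h₁
  have hz : (0 : ℂ) ≠ ((derivWithin f (Icc 0 1) 0 : ℝ) : ℂ) := fun h =>
    hf.deriv_zero_neg.ne (Complex.ofReal_eq_zero.1 h.symm)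
  -- The difference `u - k φ_x` lies in the kernel and is killed by `D(φ)`. Since `f'(0) ≠ 0`, it
  -- vanishes beyond the edge as well.
  have key := eq_zero_of_diffMul_ae_eq_zero hD hf hφ hz (u - k • ⟨hL.toLp, hdom⟩)
    (by rw [LinearPMap.map_sub, LinearPMap.map_smul, hψ, hu, smul_zero, sub_zero, zero_smul])
    (by
      filter_upwards [hW, diffMul_toLp_deriv_ae_eq D hL, Lp.coeFn_sub (u : L2) (k • hL.toLp),
        Lp.coeFn_smul k hL.toLp] with x e1 e2 e3 e4
      have e5 : diffMul D φ (⇑((u : L2) - k • hL.toLp)) x =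
          diffMul D φ u.1 x - k * diffMul D φ hL.toLp x := by
        simp only [diffMul, e3, Pi.sub_apply, e4, Pi.smul_apply, smul_eq_mul]
        ring
      refine e5.trans ?_
      rw [e1, e2, Pi.zero_apply]
      rcases lt_or_ge x x₀ with h | h
      · rw [hk x h, sub_self]
      · rw [hzero x h, frontFlux, hφ.deriv_eq_zero (h₂ x h), mul_zero, Complex.ofReal_zero,
          mul_zero, sub_self])
  have : (u : L2) = k • hL.toLp := sub_eq_zero.1 key
  rw [this]
  exact Submodule.smul_mem _ _ (Submodule.mem_span_singleton_self _)

/-- By induction, a further element `u` of a chain satisfies `𝓛 u = c φ_x`. The forcing argument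
gives `c = 0`, so `u` is already in the kernel. -/
theorem kerPow_le_span (hD : IsDegenerateDiffusivity D)
    (hf : IsBistable f α) (hDf : ∫ u in (0 : ℝ)..1, D u * f u = 0) (hφ : IsStationaryFront D f φ)
    (hL : MemLp (fun x => ((deriv φ x : ℝ) : ℂ)) 2 volume) (n : ℕ) :
    kerPow (linearizedOp hf hφ) 0 n ≤ Submodule.span ℂ {hL.toLp} := by
  obtain ⟨x₀, h₁, h₂⟩ := hφ.exists_edge hD hf hDf
  induction n with
  | zero => exact bot_le
  | succ n ih =>
    rintro _ ⟨u, hu, rfl⟩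
    have h3 : linearizedOp hf hφ u ∈ Submodule.span ℂ {hL.toLp} := by
      rw [← shiftedMap_zero_apply]
      exact ih hu
    obtain ⟨c, hc⟩ := Submodule.mem_span_singleton.1 h3
    obtain ⟨W, W₁, -, hsol, -⟩ := exists_isEdgeSolution_of_apply_eq hD hf hφ hL h₁ h₂
      (z := 0) (c := c) u (by rw [← hc, zero_smul, zero_add])
    have hc0 := hsol.eq_zero_of_forcing hD hf hDf hφ h₁ h₂
    exact mem_span_of_apply_eq_zero hD hf hDf hφ hL u (by rw [← hc, hc0, zero_smul])

theorem pointSpectrum_linearizedOp_subset (hD : IsDegenerateDiffusivity D)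
    (hf : IsBistable f α) (hDf : ∫ u in (0 : ℝ)..1, D u * f u = 0)
    (hφ : IsStationaryFront D f φ) :
    ∃ μ₀ : ℝ, 0 < μ₀ ∧
      pointSpectrum (linearizedOp hf hφ) ⊆ ((↑) : ℝ → ℂ) '' Iic (-μ₀) ∪ {0} := by
  obtain ⟨x₀, h₁, h₂⟩ := hφ.exists_edge hD hf hDf
  obtain ⟨μ, hμ, hgap⟩ := IsEdgeSolution.exists_gap hD hf hDf hφ h₁ h₂
  have hL := hφ.memLp_deriv hD hf hDf
  have hf0 := hf.deriv_zero_neg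
  -- The second entry accounts for the possible eigenvalue `f'(0)`, whose eigenfunctions may live
  -- beyond the edge and escape the analysis of `W`.
  refine ⟨min μ (-derivWithin f (Icc 0 1) 0), lt_min hμ (by linarith), fun z hz => ?_⟩
  by_cases hz0 : z = 0
  · exact Or.inr hz0
  left
  by_cases hzf : z = ((derivWithin f (Icc 0 1) 0 : ℝ) : ℂ)
  · refine ⟨_, ?_, hzf.symm⟩
    rw [mem_Iic, le_neg]
    exact min_le_right _ _
  obtain ⟨u, hu, hu0⟩ : ∃ u, shiftedMap (linearizedOp hf hφ) z u = 0 ∧ u ≠ 0 := by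
    by_contra! hn
    exact hz ((injective_iff_map_eq_zero _).2 hn)
  rw [shiftedMap_eq_zero_iff] at hu
  obtain ⟨W, W₁, hW, hsol, hzero⟩ := exists_isEdgeSolution_of_apply_eq hD hf hφ hL h₁ h₂
    (z := z) (c := 0) u (by rw [hu, zero_smul, add_zero])
  have hne : ∃ y < x₀, W y ≠ 0 := by
    by_contra! hn
    refine hu0 (Subtype.ext (eq_zero_of_diffMul_ae_eq_zero hD hf hφ hzf u hu ?_))
    filter_upwards [hW] with x hx
    rw [hx]
    exact (lt_or_ge x x₀).elim (hn x) (hzero x)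
  obtain ⟨y, hy, hWy⟩ := hne
  obtain ⟨him, hre⟩ := hsol.real_and_nonpos hD hf hDf hφ h₁ h₂ hy hWy
  have hzre : ((z.re : ℝ) : ℂ) = z := Complex.ext rfl him.symm
  refine ⟨z.re, ?_, hzre⟩
  have hle : μ ≤ ‖z‖ := by
    by_contra hlt
    exact hWy (hgap z W W₁ hsol hz0 (not_le.1 hlt) y hy)
  rw [← hzre, Complex.norm_real, Real.norm_eq_abs, abs_of_nonpos hre] at hle
  rw [mem_Iic, le_neg]
  exact (min_le_left _ _).trans hle

theorem isSimpleEigenvalue_linearizedOp_zero (hD : IsDegenerateDiffusivity D)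
    (hf : IsBistable f α) (hDf : ∫ u in (0 : ℝ)..1, D u * f u = 0)
    (hφ : IsStationaryFront D f φ) : IsSimpleEigenvalue (linearizedOp hf hφ) 0 := by
  have hL := hφ.memLp_deriv hD hf hDf
  have hne := toLp_deriv_ne_zero hD hf hDf hφ hL
  have hdom : hL.toLp ∈ (linearizedOp hf hφ).domain :=
    ⟨_, isH2WithSecondDeriv_toLp_deriv hD hf hDf hφ hL⟩
  have hψ : shiftedMap (linearizedOp hf hφ) 0 ⟨hL.toLp, hdom⟩ = 0 := by
    rw [shiftedMap_zero_apply]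
    exact (linearizedOp_eq_iff hf hφ _ _).2 (isH2WithSecondDeriv_toLp_deriv hD hf hDf hφ hL)
  have e1 : eigenspaceAt (linearizedOp hf hφ) 0 = Submodule.span ℂ {hL.toLp} := by
    refine le_antisymm ?_ ?_
    · rintro _ ⟨u, hu, rfl⟩
      refine mem_span_of_apply_eq_zero hD hf hDf hφ hL u ?_
      rw [← shiftedMap_zero_apply]
      exact hu
    · rw [Submodule.span_singleton_le_iff_mem]
      exact ⟨⟨hL.toLp, hdom⟩, hψ, rfl⟩
  have e2 : genEigenspaceAt (linearizedOp hf hφ) 0 = Submodule.span ℂ {hL.toLp} := by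
    refine le_antisymm (iSup_le fun n => kerPow_le_span hD hf hDf hφ hL n) ?_
    rw [Submodule.span_singleton_le_iff_mem]
    refine Submodule.mem_iSup_of_mem 1 ⟨⟨hL.toLp, hdom⟩, ?_, rfl⟩
    exact (Submodule.mem_bot ℂ).2 hψ
  refine ⟨fun hinj => hne ?_, ?_, ?_⟩
  · exact congrArg Subtype.val (hinj (hψ.trans (map_zero _).symm))
  · rw [e1, finrank_span_singleton hne]
  · rw [e2, finrank_span_singleton hne]

end Linearized

theorem theorem4p6 (D f φ : ℝ → ℝ) (α : ℝ) (hD : IsDegenerateDiffusivity D)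
    (hf : IsBistable f α) (hDf : ∫ u in (0 : ℝ)..1, D u * f u = 0)
    (hφ : IsStationaryFront D f φ) :
    (∃ μ₀ : ℝ, 0 < μ₀ ∧
      pointSpectrum (linearizedOp hf hφ) ⊆ ((↑) : ℝ → ℂ) '' Set.Iic (-μ₀) ∪ {0}) ∧
    IsSimpleEigenvalue (linearizedOp hf hφ) 0 ∧
    ∃ hx : MeasureTheory.MemLp (fun x => ((deriv φ x : ℝ) : ℂ)) 2 MeasureTheory.volume,
      hx.toLp ≠ 0 ∧
      ∃ hdom : hx.toLp ∈ (linearizedOp hf hφ).domain,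
        linearizedOp hf hφ ⟨hx.toLp, hdom⟩ = 0 := by
  have hL := hφ.memLp_deriv hD hf hDf
  have hH := isH2WithSecondDeriv_toLp_deriv hD hf hDf hφ hL
  exact ⟨pointSpectrum_linearizedOp_subset hD hf hDf hφ,
    isSimpleEigenvalue_linearizedOp_zero hD hf hDf hφ, hL, toLp_deriv_ne_zero hD hf hDf hφ hL,
    ⟨_, hH⟩, (linearizedOp_eq_iff hf hφ _ _).2 hH⟩
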